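/- Let $G$ be an arbitrary group and let $R=\bigoplus_{g\in G}R_g$ be a strongly $G$-graded ring (for instance a strongly $G$-graded algebra over a commutative ring), that is, $R_gR_h=R_{gh}$ for all $g,h\in G$. Put $A=R_1$, and let $R\text{-}\mathrm{Gr}$ be the category of $G$-graded left $R$-modules with degree-preserving $R$-linear maps. For a graded module $M$ and $g\in G$ let $M(g)$ be the module $M$ with the grading $M(g)_h=M_{hg}$; the same notation is used for complexes. Write $\mathscr H(-)$ and $\mathscr D(-)$ for homotopy and derived categories. For an object (or a set of objects) $X$, $\mathrm{add}(X)$ denotes the direct summands of finite direct sums of copies of $X$ (of members of $X$). Definitions. Let $A\text{-perf}\subseteq\mathscr D(A)$ be the full subcategory of objects isomorphic to bounded complexes of finitely generated projective $A$-modules, and let $R\text{-grperf}\subseteq\mathscr D(R\text{-}\mathrm{Gr})$ be the full subcategory of objects isomorphic to bounded complexes of graded $R$-modules whose terms are finitely generated projective as $R$-modules. * A complex $T$ of $A$-modules is a *tilting complex* for $A$ if it is bounded with finitely generated projective terms, $\mathrm{Hom}_{\mathscr D(A)}(T,T[n])=0$ for all $n\ne0$, and the smallest isomorphism-closed triangulated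 subcategory of $\mathscr D(A)$ containing $\mathrm{add}(T)$ is $A\text{-perf}$. * A complex $\tilde T$ of graded $R$-modules is a *$G$-graded tilting complex* for $R$ if it is bounded and its terms are finitely generated projective as $R$-modules, $\mathrm{Hom}_{\mathscr D(R\text{-}\mathrm{Gr})}(\tilde T,\tilde T(g)[n])=0$ for all $g\in G$ and $n\neq 0$, and the smallest isomorphism-closed triangulated subcategory of $\mathscr D(R\text{-}\mathrm{Gr})$ containing $\mathrm{add}\{\tilde T(g)\mid g\in G\}$ is $R\text{-grperf}$. * $\tilde T$ is *$G$-invariant* if $\tilde T(g)\simeq\tilde T$ in $\mathscr H(R\text{-}\mathrm{Gr})$ for all $g\in G$, and *weakly $G$-invariant* if $\tilde T(g)\in\mathrm{add}(\tilde T)$ in $\mathscr H(R\text{-}\mathrm{Gr})$ for all $g\in G$. Let $\tilde T$ be a weakly $G$-invariant bounded complex of graded $R$-modules, let $T=\tilde T_1$ be its identity component, a complex of $A$-modules, and let $S=\mathrm{End}_{\mathscr D(R)}(\tilde T)^{\mathrm{op}}$. For $g\in G$ let $S_g\subseteq S$ be the image of $\mathrm{Hom}_{\mathscr D(R\text{-}\mathrm{Gr})}(\tilde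 T,\tilde T(g))$ under the functor that forgets the grading. Then $T$ is a tilting complex for $A$ if and only if $\tilde T$ is a $G$-graded tilting complex for $R$. Moreover, in this case, the subgroups $S_g$ make $S$ a strongly $G$-graded ring, and $S$ is a crossed product (that is, every $S_g$ contains an invertible element of $S$) if and only if $\tilde T$ is $G$-invariant. -/

import Mathlib

open CategoryTheory Limits

universe w₁ w₂ w₃ v u

/-! ## Graded rings

The grading group is an arbitrary, not necessarily commutative, group. It is written additively,
because this is the convention of Mathlib's `GradedRing`. -/

/-- A family `𝒮` of additive subgroups of a ring `S` makes `S` a strongly `G`-graded ring: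
`S = ⨁ 𝒮 g` is a graded ring and `𝒮 g * 𝒮 h = 𝒮 (g + h)`, where the left-hand side is the
additive subgroup generated by the products. -/
structure IsStronglyGraded {G : Type v} [AddGroup G] [DecidableEq G] {S : Type u} [Ring S]
    (𝒮 : G → AddSubgroup S) : Prop where
  graded : Nonempty (GradedRing 𝒮)
  mul_eq : ∀ g h : G,
    AddSubgroup.closure {z : S | ∃ x ∈ 𝒮 g, ∃ y ∈ 𝒮 h, x * y = z} = 𝒮 (g + h)

/-- A `G`-graded ring is a crossed product if each component contains an invertible element. -/
structure IsCrossedProduct {G : Type v} [AddGroup G] [DecidableEq G] {S : Type u} [Ring S]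
    (𝒮 : G → AddSubgroup S) : Prop where
  graded : Nonempty (GradedRing 𝒮)
  exists_isUnit : ∀ g : G, ∃ x ∈ 𝒮 g, IsUnit x

/-! ## The category of graded modules -/

/-- A criterion for a family of subgroups to give a direct sum decomposition, through the
projections on the components. -/
theorem isInternal_of_proj {G : Type v} [DecidableEq G] {M : Type u} [AddCommGroup M]
    (ℳ : G → AddSubgroup M)
    (p : G → M →+ M) (hmem : ∀ g x, p g x ∈ ℳ g) (hsame : ∀ g, ∀ x ∈ ℳ g, p g x = x)
    (hne : ∀ g h, h ≠ g → ∀ x ∈ ℳ h, p g x = 0)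
    (hsum : ∀ x, ∃ s : Finset G, x = ∑ g ∈ s, p g x) : DirectSum.IsInternal ℳ := by
  constructor
  · rw [injective_iff_map_eq_zero]
    intro z hz
    have key : ∀ (g : G) (z : DirectSum G fun i => ℳ i),
        p g (DirectSum.coeAddMonoidHom ℳ z) = z g := by
      intro g z
      induction z using DirectSum.induction_on with
      | zero => simp
      | of i x =>
        rw [DirectSum.coeAddMonoidHom_of]
        by_cases h : i = g
        · subst h
          rw [DirectSum.of_eq_same, hsame _ _ x.2]
        · rw [DirectSum.of_eq_of_ne _ _ _ (Ne.symm h), hne _ _ h _ x.2]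
          rfl
      | add x y hx hy => simp [hx, hy]
    refine DFinsupp.ext fun g => Subtype.ext ?_
    have := key g z
    rw [hz, map_zero] at this
    exact this.symm
  · intro x
    obtain ⟨s, hs⟩ := hsum x
    refine ⟨∑ g ∈ s, DirectSum.of (fun i => ℳ i) g ⟨p g x, hmem g x⟩, ?_⟩
    rw [map_sum]
    conv_rhs => rw [hs]
    refine Finset.sum_congr rfl fun g _ => ?_
    rw [DirectSum.coeAddMonoidHom_of]

section GradedModules

variable {G : Type v} [AddGroup G] [DecidableEq G] {R : Type u} [Ring R]

/-- A `G`-graded left `R`-module: a left `R`-module `M` with a direct sum decomposition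
`M = ⨁ M_g` into additive subgroups such that `R_g M_h ⊆ M_{g + h}`. -/
structure GrMod (𝓡 : G → AddSubgroup R) where
  carrier : Type u
  [addCommGroup : AddCommGroup carrier]
  [module : Module R carrier]
  /-- the homogeneous components -/
  deg : G → AddSubgroup carrier
  isInternal : DirectSum.IsInternal deg
  smul_mem : ∀ {g h : G} {r : R} {m : carrier}, r ∈ 𝓡 g → m ∈ deg h → r • m ∈ deg (g + h)

attribute [instance] GrMod.addCommGroup GrMod.module

namespace GrMod

variable {𝓡 : G → AddSubgroup R}

/-- Morphisms of graded modules: `R`-linear maps that preserve the degrees. -/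
@[ext]
structure Hom (M N : GrMod 𝓡) where
  lin : M.carrier →ₗ[R] N.carrier
  map_mem : ∀ {g : G} {m : M.carrier}, m ∈ M.deg g → lin m ∈ N.deg g

/-- The category `R-Gr` of graded left `R`-modules. -/
instance : Category (GrMod 𝓡) where
  Hom M N := Hom M N
  id M := ⟨LinearMap.id, fun h => h⟩
  comp f g := ⟨g.lin ∘ₗ f.lin, fun h => g.map_mem (f.map_mem h)⟩

@[ext]
theorem hom_ext {M N : GrMod 𝓡} {f g : M ⟶ N} (h : f.lin = g.lin) : f = g :=
  Hom.ext h

@[simp] theorem id_lin (M : GrMod 𝓡) : Hom.lin (𝟙 M) = LinearMap.id := rfl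

@[simp] theorem comp_lin {M N P : GrMod 𝓡} (f : M ⟶ N) (g : N ⟶ P) :
    Hom.lin (f ≫ g) = g.lin ∘ₗ f.lin := rfl

variable {M N P : GrMod 𝓡}

instance : Zero (M ⟶ N) := ⟨⟨0, fun _ => zero_mem _⟩⟩
instance : Add (M ⟶ N) :=
  ⟨fun f g => ⟨f.lin + g.lin, fun h => add_mem (f.map_mem h) (g.map_mem h)⟩⟩
instance : Neg (M ⟶ N) := ⟨fun f => ⟨-f.lin, fun h => neg_mem (f.map_mem h)⟩⟩
instance : Sub (M ⟶ N) :=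
  ⟨fun f g => ⟨f.lin - g.lin, fun h => sub_mem (f.map_mem h) (g.map_mem h)⟩⟩
instance : SMul ℕ (M ⟶ N) :=
  ⟨fun n f => ⟨n • f.lin, fun h => nsmul_mem (f.map_mem h) n⟩⟩
instance : SMul ℤ (M ⟶ N) :=
  ⟨fun n f => ⟨n • f.lin, fun h => zsmul_mem (f.map_mem h) n⟩⟩

@[simp] theorem zero_lin : Hom.lin (0 : M ⟶ N) = 0 := rfl
@[simp] theorem add_lin (f g : M ⟶ N) : Hom.lin (f + g) = f.lin + g.lin := rfl

theorem lin_injective : Function.Injective (fun f : M ⟶ N => f.lin) := fun _ _ h => hom_ext h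

instance : AddCommGroup (M ⟶ N) :=
  lin_injective.addCommGroup _ rfl (fun _ _ => rfl) (fun _ => rfl) (fun _ _ => rfl)
    (fun _ _ => rfl) (fun _ _ => rfl)

instance : Preadditive (GrMod 𝓡) where
  add_comp _ _ _ f f' g := by ext x; simp
  comp_add _ _ _ f g g' := by ext x; simp

/-! ### Homogeneous components of elements -/

/-- The projection of a graded module on its component of degree `g`. -/
noncomputable def proj (M : GrMod 𝓡) (g : G) : M.carrier →+ M.carrier :=
  letI := M.isInternal.chooseDecomposition
  (M.deg g).subtype.comp
    ((DFinsupp.evalAddMonoidHom g).comp (DirectSum.decomposeAddEquiv M.deg).toAddMonoidHom)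

theorem proj_mem (M : GrMod 𝓡) (g : G) (x : M.carrier) : M.proj g x ∈ M.deg g :=
  SetLike.coe_mem _

theorem proj_same (M : GrMod 𝓡) (g : G) {x : M.carrier} (hx : x ∈ M.deg g) :
    M.proj g x = x := by
  let _ := M.isInternal.chooseDecomposition
  exact DirectSum.decompose_of_mem_same M.deg hx

theorem proj_ne (M : GrMod 𝓡) {g h : G} (hgh : h ≠ g) {x : M.carrier} (hx : x ∈ M.deg h) :
    M.proj g x = 0 := by
  let _ := M.isInternal.chooseDecomposition
  exact DirectSum.decompose_of_mem_ne M.deg hx hgh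

theorem exists_sum_proj (M : GrMod 𝓡) (x : M.carrier) :
    ∃ s : Finset G, x = ∑ g ∈ s, M.proj g x := by
  classical
  let _ := M.isInternal.chooseDecomposition
  exact ⟨_, (DirectSum.sum_support_decompose M.deg x).symm⟩

theorem map_proj (f : M ⟶ N) (g : G) (x : M.carrier) :
    f.lin (M.proj g x) = N.proj g (f.lin x) := by
  obtain ⟨s, hs⟩ := M.exists_sum_proj x
  have key : ∀ h, f.lin (M.proj g (M.proj h x)) = N.proj g (f.lin (M.proj h x)) := by
    intro h
    by_cases hgh : h = g
    · subst hgh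
      rw [M.proj_same h (M.proj_mem h x), N.proj_same h (f.map_mem (M.proj_mem h x))]
    · rw [M.proj_ne hgh (M.proj_mem h x), N.proj_ne hgh (f.map_mem (M.proj_mem h x)), map_zero]
  rw [hs]
  simp only [map_sum]
  exact Finset.sum_congr rfl fun h _ => key h

/-! ### Zero object and biproducts -/

/-- The zero graded module. -/
def zeroObj (𝓡 : G → AddSubgroup R) : GrMod 𝓡 where
  carrier := PUnit
  deg _ := ⊤
  isInternal := isInternal_of_proj _ (fun _ => AddMonoidHom.id _) (fun _ _ => trivial)
    (fun _ _ _ => rfl) (fun _ _ _ _ _ => rfl) (fun _ => ⟨∅, rfl⟩)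
  smul_mem _ _ := trivial

instance : HasZeroObject (GrMod 𝓡) where
  zero := ⟨zeroObj 𝓡, by
    rw [IsZero.iff_id_eq_zero]
    exact hom_ext (LinearMap.ext fun _ => rfl)⟩

/-- The direct sum of two graded modules. -/
noncomputable def prodObj (M N : GrMod 𝓡) : GrMod 𝓡 where
  carrier := M.carrier × N.carrier
  deg g := (M.deg g).prod (N.deg g)
  isInternal := isInternal_of_proj _ (fun g => (M.proj g).prodMap (N.proj g))
    (fun g x => ⟨M.proj_mem g _, N.proj_mem g _⟩)
    (fun g x hx => Prod.ext (M.proj_same g hx.1) (N.proj_same g hx.2))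
    (fun g h hgh x hx => Prod.ext (M.proj_ne hgh hx.1) (N.proj_ne hgh hx.2))
    (fun x => by
      classical
      let _ := M.isInternal.chooseDecomposition
      let _ := N.isInternal.chooseDecomposition
      have hM : ∀ t : Finset G, (DirectSum.decompose M.deg x.1).support ⊆ t →
          x.1 = ∑ g ∈ t, M.proj g x.1 := fun t ht => by
        conv_lhs => rw [← DirectSum.sum_support_decompose M.deg x.1]
        refine Finset.sum_subset ht fun i _ hi => ?_
        rw [DFinsupp.notMem_support_iff] at hi
        rw [hi]; rfl
      have hN : ∀ t : Finset G, (DirectSum.decompose N.deg x.2).support ⊆ t →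
          x.2 = ∑ g ∈ t, N.proj g x.2 := fun t ht => by
        conv_lhs => rw [← DirectSum.sum_support_decompose N.deg x.2]
        refine Finset.sum_subset ht fun i _ hi => ?_
        rw [DFinsupp.notMem_support_iff] at hi
        rw [hi]; rfl
      refine ⟨(DirectSum.decompose M.deg x.1).support ∪ (DirectSum.decompose N.deg x.2).support,
        Prod.ext ?_ ?_⟩
      · rw [Prod.fst_sum]
        exact hM _ Finset.subset_union_left
      · rw [Prod.snd_sum]
        exact hN _ Finset.subset_union_right)
  smul_mem hr hm := ⟨M.smul_mem hr hm.1, N.smul_mem hr hm.2⟩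

instance : HasBinaryBiproducts (GrMod 𝓡) where
  has_binary_biproduct M N := HasBinaryBiproduct.mk
    { bicone :=
        { pt := prodObj M N
          fst := ⟨LinearMap.fst R _ _, fun h => h.1⟩
          snd := ⟨LinearMap.snd R _ _, fun h => h.2⟩
          inl := ⟨LinearMap.inl R _ _, fun h => ⟨h, zero_mem _⟩⟩
          inr := ⟨LinearMap.inr R _ _, fun h => ⟨zero_mem _, h⟩⟩
          inl_fst := by ext x; rfl
          inl_snd := by ext x; rfl
          inr_fst := by ext x; rfl
          inr_snd := by ext x; rfl }
      isBilimit := isBinaryBilimitOfTotal _ (by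
        apply hom_ext
        refine LinearMap.ext fun x => ?_
        exact Prod.ext (add_zero x.1) (zero_add x.2)) }

instance : HasFiniteProducts (GrMod 𝓡) := hasFiniteProducts_of_has_binary_and_terminal

/-! ### Kernels and cokernels -/

/-- The kernel of a morphism of graded modules. -/
noncomputable def kerObj (f : M ⟶ N) : GrMod 𝓡 where
  carrier := LinearMap.ker f.lin
  deg g := (M.deg g).comap (LinearMap.ker f.lin).subtype.toAddMonoidHom
  isInternal := by
    have hk : ∀ g, ∀ x : LinearMap.ker f.lin, M.proj g x ∈ LinearMap.ker f.lin := fun g x => by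
      rw [LinearMap.mem_ker, map_proj, LinearMap.mem_ker.1 x.2, map_zero]
    refine isInternal_of_proj _
      (fun g => AddMonoidHom.mk' (fun x => ⟨M.proj g x, hk g x⟩) (fun a b => ?_)) ?_ ?_ ?_ ?_
    · apply Subtype.ext; simp
    · exact fun g x => M.proj_mem g _
    · exact fun g x hx => Subtype.ext (M.proj_same g hx)
    · exact fun g h hgh x hx => Subtype.ext (M.proj_ne hgh hx)
    · intro x
      obtain ⟨s, hs⟩ := M.exists_sum_proj x.1
      refine ⟨s, Subtype.ext ?_⟩
      rw [AddSubmonoidClass.coe_finsetSum]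
      exact hs
  smul_mem hr hm := M.smul_mem hr hm

/-- The inclusion of the kernel. -/
noncomputable def kerι (f : M ⟶ N) : kerObj f ⟶ M :=
  ⟨(LinearMap.ker f.lin).subtype, fun h => h⟩

theorem kerι_comp (f : M ⟶ N) : kerι f ≫ f = 0 := by
  apply hom_ext
  exact LinearMap.ext fun x => x.2

/-- The universal property of the kernel. -/
noncomputable def kerIsLimit (f : M ⟶ N) : IsLimit (KernelFork.ofι (kerι f) (kerι_comp f)) :=
  KernelFork.IsLimit.ofι _ _
    (fun k hk => ⟨k.lin.codRestrict _ fun x =>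
      LinearMap.congr_fun (congrArg (fun q => Hom.lin q) hk) x, fun h => k.map_mem h⟩)
    (fun k hk => by apply hom_ext; rfl)
    (fun k hk m hm => by
      apply hom_ext
      refine LinearMap.ext fun x => Subtype.ext ?_
      exact LinearMap.congr_fun (congrArg (fun q => Hom.lin q) hm) x)

instance : HasKernels (GrMod 𝓡) where
  has_limit f := ⟨⟨_, kerIsLimit f⟩⟩

/-- The cokernel of a morphism of graded modules. -/
noncomputable def cokObj (f : M ⟶ N) : GrMod 𝓡 where
  carrier := N.carrier ⧸ LinearMap.range f.lin
  deg g := (N.deg g).map (LinearMap.range f.lin).mkQ.toAddMonoidHom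
  isInternal := by
    have hr : ∀ g, (LinearMap.range f.lin).toAddSubgroup ≤
        (LinearMap.range f.lin).toAddSubgroup.comap (N.proj g) := by
      rintro g _ ⟨x, rfl⟩
      exact ⟨M.proj g x, map_proj f g x⟩
    refine isInternal_of_proj _ (fun g => QuotientAddGroup.map _ _ (N.proj g) (hr g)) ?_ ?_ ?_ ?_
    · intro g x
      induction x using Submodule.Quotient.induction_on with
      | H y => exact ⟨N.proj g y, N.proj_mem g y, rfl⟩
    · rintro g _ ⟨y, hy, rfl⟩
      exact congrArg (LinearMap.range f.lin).mkQ (N.proj_same g hy)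
    · rintro g h hgh _ ⟨y, hy, rfl⟩
      exact (congrArg (LinearMap.range f.lin).mkQ (N.proj_ne hgh hy)).trans (map_zero _)
    · intro x
      induction x using Submodule.Quotient.induction_on with
      | H y =>
        obtain ⟨s, hs⟩ := N.exists_sum_proj y
        refine ⟨s, ?_⟩
        exact (congrArg (LinearMap.range f.lin).mkQ hs).trans (map_sum _ _ _)
  smul_mem := by
    rintro g h r _ hr ⟨y, hy, rfl⟩
    exact ⟨r • y, N.smul_mem hr hy, map_smul (LinearMap.range f.lin).mkQ r y⟩

/-- The projection on the cokernel. -/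
noncomputable def cokπ (f : M ⟶ N) : N ⟶ cokObj f :=
  ⟨(LinearMap.range f.lin).mkQ, fun h => ⟨_, h, rfl⟩⟩

theorem comp_cokπ (f : M ⟶ N) : f ≫ cokπ f = 0 := by
  apply hom_ext
  exact LinearMap.range_mkQ_comp f.lin

/-- The universal property of the cokernel. -/
noncomputable def cokIsColimit (f : M ⟶ N) :
    IsColimit (CokernelCofork.ofπ (cokπ f) (comp_cokπ f)) :=
  CokernelCofork.IsColimit.ofπ _ _
    (fun k hk => ⟨(LinearMap.range f.lin).liftQ k.lin (by
      rintro _ ⟨x, rfl⟩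
      exact LinearMap.congr_fun (congrArg (fun q => Hom.lin q) hk) x), by
        rintro g _ ⟨y, hy, rfl⟩
        exact k.map_mem hy⟩)
    (fun k hk => by apply hom_ext; rfl)
    (fun k hk m hm => by
      apply hom_ext
      refine LinearMap.ext fun x => ?_
      induction x using Submodule.Quotient.induction_on with
      | H y => exact LinearMap.congr_fun (congrArg (fun q => Hom.lin q) hm) y)

instance : HasCokernels (GrMod 𝓡) where
  has_colimit f := ⟨⟨_, cokIsColimit f⟩⟩

theorem injective_of_mono (f : M ⟶ N) [Mono f] : Function.Injective f.lin := by
  have h : kerι f = 0 := by rw [← cancel_mono f, kerι_comp, zero_comp]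
  rw [injective_iff_map_eq_zero]
  intro x hx
  exact LinearMap.congr_fun (congrArg (fun q => Hom.lin q) h) ⟨x, hx⟩

theorem surjective_of_epi (f : M ⟶ N) [Epi f] : Function.Surjective f.lin := by
  have h : cokπ f = 0 := by rw [← cancel_epi f, comp_cokπ, comp_zero]
  intro x
  have hx : (LinearMap.range f.lin).mkQ x = 0 :=
    LinearMap.congr_fun (congrArg (fun q => Hom.lin q) h) x
  exact (Submodule.Quotient.mk_eq_zero _).1 hx

/-- Every monomorphism of graded modules is a kernel. -/
theorem nonempty_normalMono (f : M ⟶ N) [Mono f] : Nonempty (NormalMono f) := by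
  refine ⟨{ Z := cokObj f, g := cokπ f, w := comp_cokπ f, isLimit := ?_ }⟩
  focus
    have hf := injective_of_mono f
    have hk : ∀ {W : GrMod 𝓡} (k : W ⟶ N), k ≫ cokπ f = 0 → ∀ x, k.lin x ∈ LinearMap.range f.lin :=
      fun k hk x => (Submodule.Quotient.mk_eq_zero _).1
        (LinearMap.congr_fun (congrArg (fun q => Hom.lin q) hk) x)
    have hl : ∀ {W : GrMod 𝓡} (k : W ⟶ N) (hz : k ≫ cokπ f = 0) (x : W.carrier),
        f.lin ((LinearEquiv.ofInjective f.lin hf).symm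
          (k.lin.codRestrict _ (hk k hz) x)) = k.lin x := fun k hz x => by
      rw [← LinearEquiv.ofInjective_apply f.lin (h := hf), LinearEquiv.apply_symm_apply]
      rfl
    exact KernelFork.IsLimit.ofι _ _
      (fun k hz => ⟨(LinearEquiv.ofInjective f.lin hf).symm.toLinearMap ∘ₗ
        k.lin.codRestrict _ (hk k hz), fun {g x} hx => by
          set y := (LinearEquiv.ofInjective f.lin hf).symm (k.lin.codRestrict _ (hk k hz) x) with hy
          have h1 : f.lin y = k.lin x := hl k hz x
          have h2 : M.proj g y = y := hf (by
            rw [map_proj, h1, N.proj_same g (k.map_mem hx)])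
          change y ∈ M.deg g
          rw [← h2]
          exact M.proj_mem g y⟩)
      (fun k hz => by
        apply hom_ext
        exact LinearMap.ext fun x => hl k hz x)
      (fun k hz m hm => by
        rw [← cancel_mono f]
        refine hm.trans (hom_ext ?_)
        exact LinearMap.ext fun x => (hl k hz x).symm)

/-- Every epimorphism of graded modules is a cokernel. -/
theorem nonempty_normalEpi (f : M ⟶ N) [Epi f] : Nonempty (NormalEpi f) := by
  refine ⟨{ W := kerObj f, g := kerι f, w := kerι_comp f, isColimit := ?_ }⟩
  focus
    have hf := surjective_of_epi f
    have hk : ∀ {W : GrMod 𝓡} (k : M ⟶ W), kerι f ≫ k = 0 →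
        LinearMap.ker f.lin ≤ LinearMap.ker k.lin :=
      fun k hk x hx => LinearMap.congr_fun (congrArg (fun q => Hom.lin q) hk) ⟨x, hx⟩
    have hl : ∀ {W : GrMod 𝓡} (k : M ⟶ W) (hz : kerι f ≫ k = 0) (x : M.carrier),
        (LinearMap.ker f.lin).liftQ k.lin (hk k hz)
          ((f.lin.quotKerEquivOfSurjective hf).symm (f.lin x)) = k.lin x := fun k hz x => by
      have : (f.lin.quotKerEquivOfSurjective hf).symm (f.lin x) =
          (LinearMap.ker f.lin).mkQ x := by
        rw [LinearEquiv.symm_apply_eq]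
        rfl
      rw [this]
      rfl
    exact CokernelCofork.IsColimit.ofπ _ _
      (fun k hz => ⟨(LinearMap.ker f.lin).liftQ k.lin (hk k hz) ∘ₗ
        (f.lin.quotKerEquivOfSurjective hf).symm.toLinearMap, fun {g n} hn => by
          obtain ⟨m, rfl⟩ := hf n
          have h1 : f.lin (M.proj g m) = f.lin m := by rw [map_proj, N.proj_same g hn]
          have h2 := hl k hz (M.proj g m)
          rw [h1] at h2
          change (LinearMap.ker f.lin).liftQ k.lin (hk k hz)
            ((f.lin.quotKerEquivOfSurjective hf).symm (f.lin m)) ∈ _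
          rw [h2]
          exact k.map_mem (M.proj_mem g m)⟩)
      (fun k hz => by
        apply hom_ext
        exact LinearMap.ext fun x => hl k hz x)
      (fun k hz m hm => by
        rw [← cancel_epi f]
        refine hm.trans (hom_ext ?_)
        exact LinearMap.ext fun x => (hl k hz x).symm)

/-- The category of graded modules is abelian. -/
noncomputable instance : Abelian (GrMod 𝓡) where
  normalMonoOfMono f _ := nonempty_normalMono f
  normalEpiOfEpi f _ := nonempty_normalEpi f

/-! ### Forgetting the grading, suspensions, identity components -/

/-- The functor `R-Gr ⥤ R-Mod` that forgets the grading. -/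
def forget (𝓡 : G → AddSubgroup R) : GrMod 𝓡 ⥤ ModuleCat.{u} R where
  obj M := ModuleCat.of R M.carrier
  map f := ModuleCat.ofHom f.lin

instance : (forget 𝓡).Additive where

theorem forget_map_shortExact (S : ShortComplex (GrMod 𝓡)) (hS : S.ShortExact) :
    (S.map (forget 𝓡)).ShortExact := by
  have := hS.mono_f
  have := hS.epi_g
  refine
    { exact := ?_
      mono_f := (ModuleCat.mono_iff_injective _).2 (injective_of_mono S.f)
      epi_g := (ModuleCat.epi_iff_surjective _).2 (surjective_of_epi S.g) }
  rw [ShortComplex.moduleCat_exact_iff]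
  intro x hx
  have hl := (KernelFork.IsLimit.lift' hS.fIsKernel (kerι S.g) (kerι_comp S.g)).2
  exact ⟨_, LinearMap.congr_fun (congrArg (fun q => Hom.lin q) hl) ⟨x, hx⟩⟩

theorem forget_exact :
    PreservesFiniteLimits (forget 𝓡) ∧ PreservesFiniteColimits (forget 𝓡) :=
  ((Functor.exact_tfae (forget 𝓡)).out 0 3).1 forget_map_shortExact

instance : PreservesFiniteLimits (forget 𝓡) := forget_exact.1

instance : PreservesFiniteColimits (forget 𝓡) := forget_exact.2

/-- The `g`-suspension `M(g)` of a graded module: the same module, with `M(g)_h = M_{h + g}`. -/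
def suspensionObj (g : G) (M : GrMod 𝓡) : GrMod 𝓡 where
  carrier := M.carrier
  deg h := M.deg (h + g)
  isInternal := isInternal_of_proj _ (fun h => M.proj (h + g)) (fun _ _ => M.proj_mem _ _)
    (fun _ _ hx => M.proj_same _ hx) (fun _ _ hne _ hx => M.proj_ne (by simpa using hne) hx)
    (fun x => by
      classical
      obtain ⟨s, hs⟩ := M.exists_sum_proj x
      refine ⟨s.image (fun h => h - g), ?_⟩
      rw [Finset.sum_image (by intro a _ b _ h; simpa using h)]
      simpa using hs)
  smul_mem {a h r m} hr hm := by
    rw [add_assoc]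
    exact M.smul_mem hr hm

/-- The suspension functor `M ↦ M(g)`. -/
def suspension (𝓡 : G → AddSubgroup R) (g : G) : GrMod 𝓡 ⥤ GrMod 𝓡 where
  obj M := suspensionObj g M
  map f := ⟨f.lin, fun h => f.map_mem h⟩

instance (g : G) : (suspension 𝓡 g).Additive where

/-- The identity component `M_0` of a graded module is a module over the identity component
`A = R_0` of the graded ring. -/
instance [SetLike.GradedMonoid 𝓡] (M : GrMod 𝓡) : Module (𝓡 0) (M.deg 0) where
  smul r m := ⟨(r : R) • (m : M.carrier), by simpa using M.smul_mem r.2 m.2⟩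
  one_smul m := Subtype.ext (one_smul R (m : M.carrier))
  mul_smul r s m := Subtype.ext (mul_smul (r : R) (s : R) (m : M.carrier))
  smul_zero r := Subtype.ext (smul_zero (r : R))
  smul_add r m n := Subtype.ext (smul_add (r : R) (m : M.carrier) (n : M.carrier))
  add_smul r s m := Subtype.ext (add_smul (r : R) (s : R) (m : M.carrier))
  zero_smul m := Subtype.ext (zero_smul R (m : M.carrier))

/-- The functor `M ↦ M_0` from graded `R`-modules to modules over `A = R_0`. -/
def identityComponent (𝓡 : G → AddSubgroup R) [SetLike.GradedMonoid 𝓡] :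
    GrMod 𝓡 ⥤ ModuleCat.{u} (𝓡 0) where
  obj M := ModuleCat.of (𝓡 0) (M.deg 0)
  map {M N} f := ModuleCat.ofHom
    { toFun := fun m => ⟨f.lin m, f.map_mem m.2⟩
      map_add' := fun m n => Subtype.ext (map_add f.lin (m : M.carrier) n)
      map_smul' := fun r m => Subtype.ext (map_smul f.lin (r : R) (m : M.carrier)) }

instance [SetLike.GradedMonoid 𝓡] : (identityComponent 𝓡).Additive where

end GrMod

end GradedModules

/-! ## Additive and triangulated hulls -/

/-- `add P`: the direct summands of finite direct sums of objects in `P`. -/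
def addHull {C : Type*} [Category* C] [Preadditive C] [HasBinaryBiproducts C]
    [HasFiniteBiproducts C] (P : ObjectProperty C) : ObjectProperty C := fun X =>
  ∃ (n : ℕ) (Y : Fin n → C) (Z : C), (∀ i, P (Y i)) ∧ Nonempty (biprod X Z ≅ biproduct Y)

/-- The triangulated subcategory generated by `P`: the smallest isomorphism-closed triangulated
subcategory that contains the objects in `P`. -/
def triangulatedHull {C : Type*} [Category* C] [HasZeroObject C] [HasShift C ℤ] [Preadditive C]
    [∀ n : ℤ, (shiftFunctor C n).Additive] [Pretriangulated C]
    (P : ObjectProperty C) : ObjectProperty C := fun X =>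
  ∀ Q : ObjectProperty C, Q.IsTriangulated → Q.IsClosedUnderIsomorphisms → P ≤ Q → Q X

/-- A complex is bounded if all but finitely many of its terms vanish. -/
def IsBoundedComplex {C : Type*} [Category* C] [HasZeroMorphisms C]
    (K : CochainComplex C ℤ) : Prop :=
  ∃ a b : ℤ, ∀ i : ℤ, i < a ∨ b < i → IsZero (K.X i)

/-! ## Tilting complexes over a ring -/

section Tilting

variable {A : Type u} [Ring A]

/-- Bounded complexes of finitely generated projective `A`-modules. -/
structure IsPerfect (K : CochainComplex (ModuleCat.{u} A) ℤ) : Prop where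
  bounded : IsBoundedComplex K
  finite : ∀ i : ℤ, Module.Finite A (K.X i)
  projective : ∀ i : ℤ, Module.Projective A (K.X i)

/-- The full subcategory `A-perf` of `D(A)`. -/
def perf (A : Type u) [Ring A] [HasDerivedCategory.{w₁} (ModuleCat.{u} A)] :
    ObjectProperty (DerivedCategory (ModuleCat.{u} A)) := fun X =>
  ∃ K : CochainComplex (ModuleCat.{u} A) ℤ,
    IsPerfect K ∧ Nonempty (X ≅ DerivedCategory.Q.obj K)

/-- Tilting complexes for a ring `A`. -/
structure IsTiltingComplex [HasDerivedCategory.{w₁} (ModuleCat.{u} A)]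
    (T : CochainComplex (ModuleCat.{u} A) ℤ) : Prop where
  perfect : IsPerfect T
  hom_eq_zero : ∀ n : ℤ, n ≠ 0 →
    ∀ f : DerivedCategory.Q.obj T ⟶ (shiftFunctor _ n).obj (DerivedCategory.Q.obj T), f = 0
  generates : triangulatedHull (addHull (fun X => X = DerivedCategory.Q.obj T)) = perf A

end Tilting

/-! ## Graded tilting complexes -/

section GradedTilting

variable {G : Type v} [AddGroup G] [DecidableEq G] {R : Type u} [Ring R]
  {𝓡 : G → AddSubgroup R}

/-- A complex of graded `R`-modules, regarded as a complex of `R`-modules. -/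
abbrev forgetComplex (T : CochainComplex (GrMod 𝓡) ℤ) : CochainComplex (ModuleCat.{u} R) ℤ :=
  ((GrMod.forget 𝓡).mapHomologicalComplex (ComplexShape.up ℤ)).obj T

/-- The suspension `T(g)` of a complex of graded modules. -/
abbrev suspensionComplex (g : G) (T : CochainComplex (GrMod 𝓡) ℤ) : CochainComplex (GrMod 𝓡) ℤ :=
  ((GrMod.suspension 𝓡 g).mapHomologicalComplex (ComplexShape.up ℤ)).obj T

/-- The identity component of a complex of graded modules, a complex of `R_0`-modules. -/
abbrev identityComponentComplex [SetLike.GradedMonoid 𝓡] (T : CochainComplex (GrMod 𝓡) ℤ) :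
    CochainComplex (ModuleCat.{u} (𝓡 0)) ℤ :=
  ((GrMod.identityComponent 𝓡).mapHomologicalComplex (ComplexShape.up ℤ)).obj T

/-- `T` is `G`-invariant: `T(g) ≅ T` in the homotopy category `H(R-Gr)` for all `g`. -/
def IsGInvariant (T : CochainComplex (GrMod 𝓡) ℤ) : Prop :=
  ∀ g : G, Nonempty ((HomotopyCategory.quotient _ _).obj (suspensionComplex g T) ≅
    (HomotopyCategory.quotient (GrMod 𝓡) (ComplexShape.up ℤ)).obj T)

/-- `T` is weakly `G`-invariant: `T(g) ∈ add(T)` in the homotopy category `H(R-Gr)` for all `g`. -/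
def IsWeaklyGInvariant (T : CochainComplex (GrMod 𝓡) ℤ) : Prop :=
  ∀ g : G, addHull (fun X => X = (HomotopyCategory.quotient (GrMod 𝓡) (ComplexShape.up ℤ)).obj T)
    ((HomotopyCategory.quotient _ _).obj (suspensionComplex g T))

/-- The full subcategory `R-grperf` of `D(R-Gr)`: complexes of graded modules that are perfect
when regarded as complexes of `R`-modules. -/
def grperf (𝓡 : G → AddSubgroup R) [HasDerivedCategory.{w₁} (GrMod 𝓡)] :
    ObjectProperty (DerivedCategory (GrMod 𝓡)) := fun X =>
  ∃ K : CochainComplex (GrMod 𝓡) ℤ,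
    IsPerfect (forgetComplex K) ∧ Nonempty (X ≅ DerivedCategory.Q.obj K)

/-- `G`-graded tilting complexes for a `G`-graded ring `R`. -/
structure IsGradedTiltingComplex [HasDerivedCategory.{w₁} (GrMod 𝓡)]
    (T : CochainComplex (GrMod 𝓡) ℤ) : Prop where
  perfect : IsPerfect (forgetComplex T)
  hom_eq_zero : ∀ (g : G) (n : ℤ), n ≠ 0 →
    ∀ f : DerivedCategory.Q.obj T ⟶
      (shiftFunctor _ n).obj (DerivedCategory.Q.obj (suspensionComplex g T)), f = 0
  generates : triangulatedHull
    (addHull (fun X => ∃ g : G, X = DerivedCategory.Q.obj (suspensionComplex g T))) = grperf 𝓡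

/-- The ring `End_{D(R)}(T)ᵒᵖ`, for a complex `T` of graded modules. -/
abbrev EndOp [HasDerivedCategory.{w₂} (ModuleCat.{u} R)] (T : CochainComplex (GrMod 𝓡) ℤ) :
    Type w₂ :=
  (End (DerivedCategory.Q.obj (forgetComplex T)))ᵐᵒᵖ

/-- `T(g)` and `T` are the same complex of `R`-modules. -/
def forgetSuspensionIso (g : G) (T : CochainComplex (GrMod 𝓡) ℤ) :
    forgetComplex (suspensionComplex g T) ≅ forgetComplex T :=
  HomologicalComplex.Hom.isoOfComponents
    (fun i => Iso.refl (ModuleCat.of R (T.X i).carrier)) (fun _ _ _ => rfl)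

variable [HasDerivedCategory.{w₁} (GrMod 𝓡)] [HasDerivedCategory.{w₂} (ModuleCat.{u} R)]

/-- The map `Hom_{D(R-Gr)}(T, T(g)) → End_{D(R)}(T)ᵒᵖ` that forgets the grading. -/
noncomputable def gradedHomToEndOp (T : CochainComplex (GrMod 𝓡) ℤ) (g : G) :
    (DerivedCategory.Q.obj T ⟶ DerivedCategory.Q.obj (suspensionComplex g T)) →+ EndOp T where
  toFun f := MulOpposite.op
    ((GrMod.forget 𝓡).mapDerivedCategoryFactors.inv.app T ≫
      (GrMod.forget 𝓡).mapDerivedCategory.map f ≫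
      (GrMod.forget 𝓡).mapDerivedCategoryFactors.hom.app (suspensionComplex g T) ≫
      DerivedCategory.Q.map (forgetSuspensionIso g T).hom)
  map_zero' := by
    rw [Functor.map_zero, zero_comp, comp_zero]
    rfl
  map_add' f f' := by
    rw [Functor.map_add, Preadditive.add_comp, Preadditive.comp_add]
    rfl

/-- The component of degree `g` of `End_{D(R)}(T)ᵒᵖ`: the image of `Hom_{D(R-Gr)}(T, T(g))`. -/
noncomputable def endOpComponent (T : CochainComplex (GrMod 𝓡) ℤ) (g : G) :
    AddSubgroup (EndOp T) :=
  (gradedHomToEndOp T g).range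

end GradedTilting

/-!
Two facts about the graded ring `R` with identity component `A = R_0` carry the proof.

The first is Dade's theorem (`GrMod.isEquivalence_identityComponent`): since `R` is strongly graded,
the functor `M ↦ M_0` is an equivalence from graded `R`-modules to `A`-modules. Writing
`1 = ∑ aᵢ bᵢ` with `aᵢ` in `R_g` and `bᵢ` in `R_{-g}`, one recovers `M_g` from `M_0` through
`m = ∑ aᵢ (bᵢ m)`; this gives full faithfulness, and essential surjectivity follows by presenting an
`A`-module by free modules, which lift to free graded modules. The equivalence matches finitely
generated projective objects on both sides, so the induced triangulated equivalence
`D(R-Gr) ≌ D(A)` takes `R-grperf` to `A-perf` and `T` to its identity component. Weak invariance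
says that each `T(g)` is a summand of a finite sum of copies of `T`, whence the suspensions of `T`
add nothing to the additive hull of `T` and `Hom(T, T(g)[n])` vanishes as soon as `Hom(T, T[n])`
does. This is `IsWeaklyGInvariant.isTiltingComplex_iff`.

The second is that a bounded complex of projectives is K-projective, so that morphisms from `T` in
the derived categories are homotopy classes of maps of complexes, both over `R` and in the graded
setting. An `R`-linear map between graded modules has a component of degree `g`, which is again
linear; taking components is compatible with graded differentials, hence also applies to homotopies,
and a linear map on a finitely generated module is the sum of finitely many of its components. Hence
`S = End_{D(R)}(T)ᵒᵖ` is the direct sum of the subgroups `S_g` of classes of maps of degree `g`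
(`isInternal_endOpComponent`). Weak invariance writes the identity of `T(g)` as a sum of composites
`T(g) ⟶ T ⟶ T(g)`, that is, `1 ∈ S_{-g} S_g`, and this makes `S` strongly graded. Finally, a unit
in `S_g` has its inverse in `S_{-g}`, and the degree `0` components of the homotopies relating the
two composites to the identity show that the unit is an isomorphism `T ≅ T(g)` in `H(R-Gr)`.
-/

/-! ### Strongly graded rings -/

section StronglyGraded

variable {G : Type v} [AddGroup G] [DecidableEq G] {R : Type u} [Ring R]

theorem AddSubgroup.exists_sum_mul_of_mem_closure {X Y : AddSubgroup R} {z : R}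
    (hz : z ∈ AddSubgroup.closure {z : R | ∃ x ∈ X, ∃ y ∈ Y, x * y = z}) :
    ∃ (ι : Type) (_ : Fintype ι) (a b : ι → R), (∀ i, a i ∈ X) ∧ (∀ i, b i ∈ Y) ∧
      ∑ i, a i * b i = z := by
  induction hz using AddSubgroup.closure_induction with
  | mem z hz =>
    obtain ⟨x, hx, y, hy, rfl⟩ := hz
    exact ⟨Unit, inferInstance, fun _ => x, fun _ => y, fun _ => hx, fun _ => hy, by simp⟩
  | zero => exact ⟨Empty, inferInstance, fun _ => 0, fun _ => 0, nofun, nofun, by simp⟩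
  | add z z' _ _ h h' =>
    obtain ⟨ι, _, a, b, ha, hb, rfl⟩ := h
    obtain ⟨ι', _, a', b', ha', hb', rfl⟩ := h'
    refine ⟨ι ⊕ ι', inferInstance, Sum.elim a a', Sum.elim b b', ?_, ?_, by simp⟩
    · rintro (i | i)
      exacts [ha i, ha' i]
    · rintro (i | i)
      exacts [hb i, hb' i]
  | neg z _ h =>
    obtain ⟨ι, _, a, b, ha, hb, rfl⟩ := h
    exact ⟨ι, inferInstance, fun i => -a i, b, fun i => neg_mem (ha i), hb, by simp⟩

theorem IsStronglyGraded.exists_sum_mul_eq_one {𝓡 : G → AddSubgroup R} [SetLike.GradedMonoid 𝓡]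
    (hR : IsStronglyGraded 𝓡) (g : G) :
    ∃ (ι : Type) (_ : Fintype ι) (a b : ι → R), (∀ i, a i ∈ 𝓡 g) ∧ (∀ i, b i ∈ 𝓡 (-g)) ∧
      ∑ i, a i * b i = 1 := by
  apply AddSubgroup.exists_sum_mul_of_mem_closure
  rw [hR.mul_eq, add_neg_cancel]
  exact SetLike.GradedOne.one_mem

/-- A graded ring `S` is strongly graded as soon as `1 ∈ S_{-g} S_g` for all `g`. -/
theorem IsStronglyGraded.of_one_mem {𝒮 : G → AddSubgroup R} (h𝒮 : GradedRing 𝒮)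
    (h : ∀ g, (1 : R) ∈ AddSubgroup.closure {z : R | ∃ x ∈ 𝒮 (-g), ∃ y ∈ 𝒮 g, x * y = z}) :
    IsStronglyGraded 𝒮 where
  graded := ⟨h𝒮⟩
  mul_eq g k := by
    apply le_antisymm
    · rw [AddSubgroup.closure_le]
      rintro _ ⟨x, hx, y, hy, rfl⟩
      exact SetLike.GradedMul.mul_mem hx hy
    · intro z hz
      obtain ⟨ι, _, a, b, ha, hb, hab⟩ := AddSubgroup.exists_sum_mul_of_mem_closure (h k)
      -- `z = ∑ (z aᵢ) bᵢ`, with `z aᵢ ∈ S_{g + k - k}`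
      rw [← mul_one z, ← hab, Finset.mul_sum]
      refine sum_mem fun i _ => AddSubgroup.subset_closure ⟨z * a i, ?_, b i, hb i, mul_assoc _ _ _⟩
      have := SetLike.GradedMul.mul_mem hz (ha i)
      rwa [add_neg_cancel_right] at this

/-- The inverse of a homogeneous element of degree `g` is homogeneous of degree `-g`. -/
theorem mem_neg_of_mul_eq_one (𝒮 : G → AddSubgroup R) [GradedRing 𝒮] {g : G}
    {x y : R} (hx : x ∈ 𝒮 g) (h : x * y = 1) (h' : y * x = 1) : y ∈ 𝒮 (-g) := by
  have h1 := DirectSum.coe_decompose_mul_add_of_left_mem 𝒮 (j := -g) (b := y) hx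
  rw [h, add_neg_cancel, DirectSum.decompose_of_mem_same 𝒮 SetLike.GradedOne.one_mem] at h1
  rw [← mul_one y, h1, ← mul_assoc, h', one_mul]
  exact SetLike.coe_mem _

end StronglyGraded

/-! ### Additive maps between graded modules -/

namespace GrMod

variable {G : Type v} [AddGroup G] [DecidableEq G] {R : Type u} [Ring R] {𝓡 : G → AddSubgroup R}
  {M N P : GrMod 𝓡}

/-- Two additive maps that agree on homogeneous elements are equal. -/
theorem addMonoidHom_ext {B : Type*} [AddCommMonoid B] {φ ψ : M.carrier →+ B}
    (h : ∀ g, ∀ m ∈ M.deg g, φ m = ψ m) : φ = ψ := by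
  ext x
  obtain ⟨s, hs⟩ := M.exists_sum_proj x
  rw [hs, map_sum, map_sum]
  exact Finset.sum_congr rfl fun g _ => h g _ (M.proj_mem g x)

theorem linearMap_ext {φ ψ : M.carrier →ₗ[R] N.carrier}
    (h : ∀ g, ∀ m ∈ M.deg g, φ m = ψ m) : φ = ψ :=
  LinearMap.toAddMonoidHom_injective (addMonoidHom_ext h)

/-- The additive map on `M` that is given by `φ g` on the component of degree `g`. -/
noncomputable def glue {B : Type*} [AddCommMonoid B] (φ : ∀ g, M.deg g →+ B) : M.carrier →+ B :=
  letI := M.isInternal.chooseDecomposition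
  (DirectSum.toAddMonoid φ).comp (DirectSum.decomposeAddEquiv M.deg).toAddMonoidHom

theorem glue_apply {B : Type*} [AddCommMonoid B] (φ : ∀ g, M.deg g →+ B) {g : G} {m : M.carrier}
    (hm : m ∈ M.deg g) : glue φ m = φ g ⟨m, hm⟩ := by
  let _ := M.isInternal.chooseDecomposition
  change DirectSum.toAddMonoid φ (DirectSum.decompose M.deg m) = _
  rw [DirectSum.decompose_of_mem _ hm, DirectSum.toAddMonoid_of]

/-- Linearity of an additive map may be checked on homogeneous elements. -/
theorem map_smul_of_homogeneous [GradedRing 𝓡] (φ : M.carrier →+ N.carrier)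
    (h : ∀ g k, ∀ r ∈ 𝓡 g, ∀ m ∈ M.deg k, φ (r • m) = r • φ m) (r : R) (m : M.carrier) :
    φ (r • m) = r • φ m := by
  induction r using DirectSum.Decomposition.inductionOn 𝓡 with
  | zero => simp
  | homogeneous r =>
    have : φ.comp (DistribSMul.toAddMonoidHom M.carrier (r : R)) =
        (DistribSMul.toAddMonoidHom N.carrier (r : R)).comp φ :=
      addMonoidHom_ext fun k m hm => h _ k r r.2 m hm
    exact DFunLike.congr_fun this m
  | add r s hr hs => simp [add_smul, hr, hs]

/-- Multiplication by a homogeneous element of degree `g` shifts the projections by `g`. -/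
theorem proj_smul (M : GrMod 𝓡) {g : G} {r : R} (hr : r ∈ 𝓡 g) (k : G) (x : M.carrier) :
    M.proj (g + k) (r • x) = r • M.proj k x := by
  have : (M.proj (g + k)).comp (DistribSMul.toAddMonoidHom M.carrier r) =
      (DistribSMul.toAddMonoidHom M.carrier r).comp (M.proj k) := by
    refine addMonoidHom_ext fun l m hm => ?_
    change M.proj (g + k) (r • m) = r • M.proj k m
    by_cases hl : l = k
    · subst hl
      rw [M.proj_same _ hm, M.proj_same _ (M.smul_mem hr hm)]
    · rw [M.proj_ne hl hm, smul_zero, M.proj_ne _ (M.smul_mem hr hm)]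
      simpa using hl
  exact DFunLike.congr_fun this x

/-! ### Graded components of linear maps -/

/-- The component of degree `g` of a linear map `f`, which maps `m` in `M_h` to the component of
degree `h + g` of `f m`. -/
noncomputable def linComponent [GradedRing 𝓡] (g : G) (f : M.carrier →ₗ[R] N.carrier) :
    M.carrier →ₗ[R] N.carrier :=
  let φ : M.carrier →+ N.carrier :=
    glue fun h => ((N.proj (h + g)).comp f.toAddMonoidHom).comp (M.deg h).subtype
  { φ with
    map_smul' := map_smul_of_homogeneous φ fun k h r hr m hm => by
      rw [glue_apply _ hm, glue_apply _ (M.smul_mem hr hm)]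
      change N.proj (k + h + g) (f (r • m)) = r • N.proj (h + g) (f m)
      rw [map_smul, add_assoc, proj_smul _ hr] }

variable [GradedRing 𝓡]

theorem linComponent_apply (g : G) (f : M.carrier →ₗ[R] N.carrier) {h : G} {m : M.carrier}
    (hm : m ∈ M.deg h) : linComponent g f m = N.proj (h + g) (f m) :=
  glue_apply _ hm

theorem linComponent_mem (g : G) (f : M.carrier →ₗ[R] N.carrier) {h : G} {m : M.carrier}
    (hm : m ∈ M.deg h) : linComponent g f m ∈ N.deg (h + g) := by
  rw [linComponent_apply g f hm]
  exact N.proj_mem _ _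

theorem linComponent_add (g : G) (f f' : M.carrier →ₗ[R] N.carrier) :
    linComponent g (f + f') = linComponent g f + linComponent g f' :=
  linearMap_ext fun h m hm => by simp [linComponent_apply _ _ hm]

theorem linComponent_zero (g : G) : linComponent g (0 : M.carrier →ₗ[R] N.carrier) = 0 :=
  linearMap_ext fun h m hm => by simp [linComponent_apply _ _ hm]

theorem linComponent_same {g : G} {f : M.carrier →ₗ[R] N.carrier}
    (hf : ∀ h, ∀ m ∈ M.deg h, f m ∈ N.deg (h + g)) : linComponent g f = f :=
  linearMap_ext fun h m hm => by rw [linComponent_apply _ _ hm, N.proj_same _ (hf h m hm)]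

theorem linComponent_ne {g k : G} (hk : k ≠ g) {f : M.carrier →ₗ[R] N.carrier}
    (hf : ∀ h, ∀ m ∈ M.deg h, f m ∈ N.deg (h + k)) : linComponent g f = 0 :=
  linearMap_ext fun h m hm => by
    rw [linComponent_apply _ _ hm, N.proj_ne (by simpa using hk) (hf h m hm)]
    rfl

theorem linComponent_comp_hom (g : G) (f : M.carrier →ₗ[R] N.carrier) (p : N ⟶ P) :
    linComponent g (p.lin ∘ₗ f) = p.lin ∘ₗ linComponent g f :=
  linearMap_ext fun h m hm => by
    rw [LinearMap.comp_apply, linComponent_apply _ _ hm, linComponent_apply _ _ hm, map_proj]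
    rfl

theorem linComponent_hom_comp (g : G) (p : M ⟶ N) (f : N.carrier →ₗ[R] P.carrier) :
    linComponent g (f ∘ₗ p.lin) = linComponent g f ∘ₗ p.lin :=
  linearMap_ext fun h m hm => by
    rw [LinearMap.comp_apply, linComponent_apply _ _ hm, linComponent_apply _ _ (p.map_mem hm)]
    rfl

omit [GradedRing 𝓡] in
/-- Every large enough finite set of degrees contains all degrees in which `x` has a nonzero
component. -/
theorem exists_forall_sum_proj (M : GrMod 𝓡) (x : M.carrier) :
    ∃ s : Finset G, ∀ t, s ⊆ t → x = ∑ g ∈ t, M.proj g x := by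
  classical
  let _ := M.isInternal.chooseDecomposition
  refine ⟨(DirectSum.decompose M.deg x).support, fun t ht => ?_⟩
  conv_lhs => rw [← DirectSum.sum_support_decompose M.deg x]
  refine Finset.sum_subset ht fun i _ hi => ?_
  rw [DFinsupp.notMem_support_iff] at hi
  rw [hi]
  rfl

/-- A linear map on a finitely generated graded module is the sum of finitely many homogeneous
components. The sum may be taken over any larger set, so that a common set of degrees serves for
finitely many maps. -/
theorem exists_forall_sum_linComponent [Module.Finite R M.carrier]
    (f : M.carrier →ₗ[R] N.carrier) :
    ∃ s : Finset G, ∀ t, s ⊆ t → f = ∑ g ∈ t, linComponent g f := by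
  have hom : ∀ (h : G) (x : M.carrier), x ∈ M.deg h →
      ∃ s : Finset G, ∀ t, s ⊆ t → f x = ∑ g ∈ t, linComponent g f x := by
    intro h x hx
    obtain ⟨s, hs⟩ := N.exists_forall_sum_proj (f x)
    refine ⟨s.image (fun k => -h + k), fun t ht => ?_⟩
    simp only [linComponent_apply _ f hx]
    have hst : s ⊆ t.image (fun g => h + g) := fun k hk =>
      Finset.mem_image.2 ⟨-h + k, ht (Finset.mem_image_of_mem _ hk), by simp⟩
    exact (hs _ hst).trans (Finset.sum_image fun a _ b _ hab => add_left_cancel hab)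
  have all : ∀ x : M.carrier,
      ∃ s : Finset G, ∀ t, s ⊆ t → f x = ∑ g ∈ t, linComponent g f x := by
    intro x
    obtain ⟨u, hu⟩ := M.exists_sum_proj x
    choose s hs using fun h => hom h (M.proj h x) (M.proj_mem h x)
    refine ⟨u.biUnion s, fun t ht => ?_⟩
    rw [hu, map_sum, Finset.sum_congr rfl fun h hh =>
      hs h t ((Finset.subset_biUnion_of_mem s hh).trans ht), Finset.sum_comm]
    exact Finset.sum_congr rfl fun g _ => (map_sum _ _ _).symm
  choose s hs using all
  -- it suffices to compare both sides on finitely many generators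
  obtain ⟨S, hS⟩ := Module.Finite.fg_top (R := R) (M := M.carrier)
  refine ⟨S.biUnion s, fun t ht => LinearMap.ext_on hS fun x hx => ?_⟩
  rw [LinearMap.sum_apply]
  exact hs x t ((Finset.subset_biUnion_of_mem s hx).trans ht)

end GrMod

/-! ### Graded modules over a strongly graded ring -/

namespace GrMod

variable {G : Type v} [AddGroup G] [DecidableEq G] {R : Type u} [Ring R] {𝓡 : G → AddSubgroup R}
  [GradedRing 𝓡] {M N P : GrMod 𝓡}

omit [GradedRing 𝓡] in
theorem neg_smul_mem (M : GrMod 𝓡) {g : G} {b : R} (hb : b ∈ 𝓡 (-g)) {m : M.carrier}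
    (hm : m ∈ M.deg g) : b • m ∈ M.deg 0 := by
  simpa using M.smul_mem hb hm

/-- Over a strongly graded ring, an element is determined by its multiples by `R_{-g}`. -/
theorem eq_of_smul_eq (hR : IsStronglyGraded 𝓡) (g : G) {x y : M.carrier}
    (h : ∀ b ∈ 𝓡 (-g), b • x = b • y) : x = y := by
  obtain ⟨ι, _, a, b, -, hb, hab⟩ := hR.exists_sum_mul_eq_one g
  rw [← one_smul R x, ← one_smul R y, ← hab, Finset.sum_smul, Finset.sum_smul]
  exact Finset.sum_congr rfl fun i _ => by rw [mul_smul, mul_smul, h _ (hb i)]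

theorem faithful_identityComponent (hR : IsStronglyGraded 𝓡) :
    (identityComponent 𝓡).Faithful where
  map_injective {M N f f'} h := by
    apply hom_ext
    refine linearMap_ext fun g m hm => eq_of_smul_eq hR g fun b hb => ?_
    rw [← map_smul, ← map_smul]
    exact congrArg Subtype.val
      (LinearMap.congr_fun (congrArg ModuleCat.Hom.hom h) ⟨b • m, M.neg_smul_mem hb hm⟩)

/-- Over a strongly graded ring, a linear map `φ` between identity components extends to graded
modules: if `1 = ∑ aᵢ bᵢ` with `aᵢ` in `R_g` and `bᵢ` in `R_{-g}`, then the extension maps `m` in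
`M_g` to `∑ aᵢ φ(bᵢ m)`. -/
theorem exists_extension (hR : IsStronglyGraded 𝓡) (φ : M.deg 0 →ₗ[𝓡 0] N.deg 0) :
    ∃ f : M ⟶ N, ∀ m : M.deg 0, f.lin m = φ m := by
  choose ι hι a b ha hb hab using hR.exists_sum_mul_eq_one
  let ψ (g : G) : M.deg g →+ N.carrier := ∑ i, (DistribSMul.toAddMonoidHom N.carrier (a g i)).comp
    ((N.deg 0).subtype.comp (φ.toAddMonoidHom.comp
      (AddMonoidHom.mk' (fun m => ⟨b g i • (m : M.carrier), M.neg_smul_mem (hb g i) m.2⟩)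
        fun x y => Subtype.ext (smul_add (b g i) (x : M.carrier) y))))
  have hψ : ∀ g (m : M.deg g), ψ g m = ∑ i, a g i •
      (φ ⟨b g i • (m : M.carrier), M.neg_smul_mem (hb g i) m.2⟩ : N.carrier) := fun g m => by
    simp only [ψ, AddMonoidHom.finsetSum_apply]
    rfl
  -- the characterization of the extension: `c f(m) = φ(c m)` for `c` in `R_{-g}`
  have key : ∀ g (m : M.carrier) (hm : m ∈ M.deg g) (c : R) (hc : c ∈ 𝓡 (-g)),
      c • glue ψ m = (φ ⟨c • m, M.neg_smul_mem hc hm⟩ : N.carrier) := fun g m hm c hc => by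
    rw [glue_apply _ hm, hψ, Finset.smul_sum]
    have hca : ∀ i, c * a g i ∈ 𝓡 0 := fun i => by
      simpa using SetLike.GradedMul.mul_mem hc (ha g i)
    have h1 : ∀ i, c • a g i • (φ ⟨b g i • m, M.neg_smul_mem (hb g i) hm⟩ : N.carrier) =
        (φ ((⟨c * a g i, hca i⟩ : 𝓡 0) • ⟨b g i • m, M.neg_smul_mem (hb g i) hm⟩) :
          N.carrier) := fun i => by
      rw [map_smul, ← mul_smul]
      rfl
    rw [Finset.sum_congr rfl fun i _ => h1 i, ← AddSubmonoidClass.coe_finsetSum, ← map_sum]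
    congr 2
    apply Subtype.ext
    rw [AddSubmonoidClass.coe_finsetSum]
    change ∑ i, (c * a g i) • b g i • m = c • m
    simp_rw [← mul_smul, mul_assoc]
    rw [← Finset.sum_smul, ← Finset.mul_sum, hab, mul_one]
  let f : M.carrier →ₗ[R] N.carrier :=
    { glue ψ with
      map_smul' := map_smul_of_homogeneous (glue ψ) fun g k r hr m hm => by
        refine eq_of_smul_eq hR (g + k) fun c hc => ?_
        have hcr : c * r ∈ 𝓡 (-k) := by
          simpa [neg_add_rev] using SetLike.GradedMul.mul_mem hc hr
        have h1 : (⟨c • r • m, M.neg_smul_mem hc (M.smul_mem hr hm)⟩ : M.deg 0) =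
            ⟨(c * r) • m, M.neg_smul_mem hcr hm⟩ := Subtype.ext (mul_smul c r m).symm
        refine (key _ _ (M.smul_mem hr hm) c hc).trans ?_
        rw [h1, ← key k m hm _ hcr, mul_smul] }
  refine ⟨⟨f, fun {g m} hm => ?_⟩, fun m => ?_⟩
  · change glue ψ m ∈ _
    rw [glue_apply _ hm, hψ]
    refine sum_mem fun i _ => ?_
    have := N.smul_mem (ha g i) (φ ⟨b g i • m, M.neg_smul_mem (hb g i) hm⟩).2
    rwa [add_zero] at this
  · change glue ψ m = _
    have h1 : (1 : R) ∈ 𝓡 (-0) := by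
      rw [neg_zero]
      exact SetLike.GradedOne.one_mem
    rw [← one_smul R (glue ψ (m : M.carrier)), key 0 m m.2 1 h1]
    congr 2
    exact Subtype.ext (one_smul R (m : M.carrier))

theorem full_identityComponent (hR : IsStronglyGraded 𝓡) : (identityComponent 𝓡).Full where
  map_surjective {M N} φ := by
    obtain ⟨f, hf⟩ := exists_extension hR φ.hom
    exact ⟨f, ModuleCat.hom_ext (LinearMap.ext fun m => Subtype.ext (hf m))⟩

/-! ### Free graded modules -/

/-- The free graded module on generators of degree `0` indexed by `I`. -/
noncomputable def free (𝓡 : G → AddSubgroup R) [GradedRing 𝓡] (I : Type u) : GrMod 𝓡 where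
  carrier := I →₀ R
  deg g :=
    { carrier := {x | ∀ i, x i ∈ 𝓡 g}
      add_mem' := fun hx hy i => add_mem (hx i) (hy i)
      zero_mem' := fun _ => zero_mem _
      neg_mem' := fun hx i => neg_mem (hx i) }
  isInternal := isInternal_of_proj _
    (fun g => Finsupp.mapRange.addMonoidHom (GradedRing.proj 𝓡 g))
    (fun g x i => SetLike.coe_mem _)
    (fun g x hx => Finsupp.ext fun i => DirectSum.decompose_of_mem_same 𝓡 (hx i))
    (fun g h hgh x hx => Finsupp.ext fun i => DirectSum.decompose_of_mem_ne 𝓡 (hx i) hgh)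
    (fun x => by
      classical
      refine ⟨x.support.biUnion fun i => (DirectSum.decompose 𝓡 (x i)).support,
        Finsupp.ext fun i => ?_⟩
      rw [Finsupp.finsetSum_apply]
      by_cases hi : i ∈ x.support
      · conv_lhs => rw [← DirectSum.sum_support_decompose 𝓡 (x i)]
        refine Finset.sum_subset (Finset.subset_biUnion_of_mem
          (fun i => (DirectSum.decompose 𝓡 (x i)).support) hi) fun g _ hg => ?_
        rw [DFinsupp.notMem_support_iff] at hg
        rw [hg]
        rfl
      · rw [Finsupp.notMem_support_iff] at hi
        simp [hi])
  smul_mem hr hm i := SetLike.GradedMul.mul_mem hr (hm i)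

/-- The identity component of the free graded module is free. -/
noncomputable def freeDegZeroEquiv (I : Type u) : (I →₀ 𝓡 0) ≃ₗ[𝓡 0] (free 𝓡 I).deg 0 where
  toFun x := ⟨Finsupp.mapRange.addMonoidHom (𝓡 0).subtype x, fun i => (x i).2⟩
  map_add' x y := Subtype.ext (map_add _ x y)
  map_smul' _ _ := Subtype.ext (Finsupp.ext fun _ => rfl)
  invFun x :=
    let y : I →₀ R := x.1
    Finsupp.onFinset y.support (fun i => ⟨y i, x.2 i⟩) fun _ hi =>
      Finsupp.mem_support_iff.2 fun h => hi (Subtype.ext h)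
  left_inv _ := Finsupp.ext fun _ => rfl
  right_inv _ := Subtype.ext (Finsupp.ext fun _ => rfl)

instance (I : Type u) : Module.Free R (free 𝓡 I).carrier :=
  inferInstanceAs (Module.Free R (I →₀ R))

end GrMod

namespace GrMod

variable {G : Type v} [AddGroup G] [DecidableEq G] {R : Type u} [Ring R] {𝓡 : G → AddSubgroup R}
  [GradedRing 𝓡] {M N P : GrMod 𝓡}

/-! ### The equivalence between graded modules and modules over the identity component -/

theorem identityComponent_map_surjective (f : M ⟶ N) (hf : Function.Surjective f.lin) :
    Function.Surjective ((identityComponent 𝓡).map f).hom := by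
  rintro ⟨n, hn⟩
  obtain ⟨m, rfl⟩ := hf n
  refine ⟨⟨M.proj 0 m, M.proj_mem 0 m⟩, Subtype.ext ?_⟩
  change f.lin (M.proj 0 m) = _
  rw [map_proj, N.proj_same 0 hn]

/-- Every submodule is the image of a map from the identity component of a free graded module, with
one generator for each element. -/
theorem exists_free_degZero_range_eq {B : Type u} [AddCommGroup B] [Module (𝓡 0) B]
    (K : Submodule (𝓡 0) B) :
    ∃ (I : Type u) (φ : (free 𝓡 I).deg 0 →ₗ[𝓡 0] B), LinearMap.range φ = K := by
  refine ⟨K, K.subtype ∘ₗ Finsupp.linearCombination (𝓡 0) (id : K → K) ∘ₗ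
    (freeDegZeroEquiv (𝓡 := 𝓡) K).symm.toLinearMap, ?_⟩
  rw [LinearMap.range_comp, LinearMap.range_comp, LinearEquiv.range, Submodule.map_top,
    LinearMap.range_eq_top.2 (Finsupp.linearCombination_id_surjective _ _), Submodule.map_top,
    Submodule.range_subtype]

/-- Every `A`-module is the identity component of the cokernel of a map of free graded modules that
extends a free presentation. -/
theorem essSurj_identityComponent (hR : IsStronglyGraded 𝓡) :
    (identityComponent 𝓡).EssSurj where
  mem_essImage B := by
    obtain ⟨I, π, hπ⟩ := exists_free_degZero_range_eq (𝓡 := 𝓡) (⊤ : Submodule (𝓡 0) B)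
    obtain ⟨J, ψ, hψ⟩ := exists_free_degZero_range_eq (𝓡 := 𝓡) (LinearMap.ker π)
    obtain ⟨k, hk⟩ := exists_extension hR ψ
    let q : (free 𝓡 I).deg 0 →ₗ[𝓡 0] (cokObj k).deg 0 :=
      ((identityComponent 𝓡).map (cokπ k)).hom
    have hq : Function.Surjective q :=
      identityComponent_map_surjective _ (Submodule.mkQ_surjective _)
    have hker : LinearMap.ker q = LinearMap.ker π := by
      rw [← hψ]
      ext ⟨y, hy⟩
      rw [LinearMap.mem_ker, LinearMap.mem_range, Subtype.ext_iff]
      refine (Submodule.Quotient.mk_eq_zero _).trans ⟨?_, ?_⟩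
      · rintro ⟨x, rfl⟩
        refine ⟨⟨_, (free 𝓡 J).proj_mem 0 x⟩, Subtype.ext ?_⟩
        rw [← hk]
        change k.lin _ = k.lin x
        rw [map_proj, (free 𝓡 I).proj_same 0 hy]
      · rintro ⟨x, hx⟩
        exact ⟨x, (hk x).trans (congrArg Subtype.val hx)⟩
    exact ⟨cokObj k, ⟨LinearEquiv.toModuleIso
      ((LinearMap.quotKerEquivOfSurjective q hq).symm ≪≫ₗ Submodule.quotEquivOfEq _ _ hker ≪≫ₗ
        LinearMap.quotKerEquivOfSurjective π (LinearMap.range_eq_top.1 hπ))⟩⟩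

/-- Dade's theorem: over a strongly graded ring `R`, graded modules are equivalent to modules over
the identity component of `R`. -/
theorem isEquivalence_identityComponent (hR : IsStronglyGraded 𝓡) :
    (identityComponent 𝓡).IsEquivalence where
  faithful := faithful_identityComponent hR
  full := full_identityComponent hR
  essSurj := essSurj_identityComponent hR

/-! ### Finitely generated and projective graded modules -/

theorem span_deg_zero (hR : IsStronglyGraded 𝓡) (M : GrMod 𝓡) :
    Submodule.span R (M.deg 0 : Set M.carrier) = ⊤ := by
  rw [eq_top_iff]
  rintro x -
  obtain ⟨s, hs⟩ := M.exists_sum_proj x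
  rw [hs]
  refine sum_mem fun g _ => ?_
  obtain ⟨ι, _, a, b, ha, hb, hab⟩ := hR.exists_sum_mul_eq_one g
  rw [← one_smul R (M.proj g x), ← hab, Finset.sum_smul]
  refine sum_mem fun i _ => ?_
  rw [mul_smul]
  exact Submodule.smul_mem _ _ (Submodule.subset_span (M.neg_smul_mem (hb i) (M.proj_mem g x)))

theorem proj_zero_smul (M : GrMod 𝓡) (r : R) {m : M.carrier} (hm : m ∈ M.deg 0) :
    M.proj 0 (r • m) = (DirectSum.decompose 𝓡 r 0 : R) • m := by
  induction r using DirectSum.Decomposition.inductionOn 𝓡 with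
  | zero => simp
  | @homogeneous g r =>
    have hrm : (r : R) • m ∈ M.deg g := by simpa using M.smul_mem r.2 hm
    by_cases hg : g = 0
    · subst hg
      rw [M.proj_same 0 hrm, DirectSum.decompose_of_mem_same 𝓡 r.2]
    · rw [M.proj_ne hg hrm, DirectSum.decompose_of_mem_ne 𝓡 r.2 hg, zero_smul]
  | add r s hr hs => simp [add_smul, hr, hs]

/-- If elements of `M_0` generate the `R`-module `M`, then they generate the `A`-module `M_0`. -/
theorem span_deg_zero_eq_top {S : Set (M.deg 0)}
    (hS : Submodule.span R (Subtype.val '' S) = (⊤ : Submodule R M.carrier)) :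
    Submodule.span (𝓡 0) S = ⊤ := by
  rw [eq_top_iff]
  rintro ⟨x, hx⟩ -
  have hxS : x ∈ Submodule.span R (Subtype.val '' S) := hS ▸ Submodule.mem_top
  obtain ⟨n, r, s, hrs⟩ := Submodule.mem_span_set'.1 hxS
  choose t ht hts using fun i => (s i).2
  have : (⟨x, hx⟩ : M.deg 0) = ∑ i, DirectSum.decompose 𝓡 (r i) 0 • t i := by
    apply Subtype.ext
    rw [AddSubmonoidClass.coe_finsetSum]
    refine (M.proj_same 0 hx).symm.trans ?_
    rw [← hrs, map_sum]
    refine Finset.sum_congr rfl fun i _ => ?_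
    rw [← hts i, M.proj_zero_smul _ (t i).2]
    rfl
  rw [this]
  exact sum_mem fun i _ => Submodule.smul_mem _ _ (Submodule.subset_span (ht i))

theorem finite_iff_finite_deg_zero (hR : IsStronglyGraded 𝓡) (M : GrMod 𝓡) :
    Module.Finite R M.carrier ↔ Module.Finite (𝓡 0) (M.deg 0) := by
  constructor
  · intro h
    have h1 := h.fg_top
    rw [← span_deg_zero hR M, Submodule.fg_span_iff_fg_span_finset_subset] at h1
    obtain ⟨t, ht, htop⟩ := h1
    refine ⟨Submodule.fg_def.2 ⟨Subtype.val ⁻¹' (t : Set M.carrier),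
      t.finite_toSet.preimage Subtype.val_injective.injOn, span_deg_zero_eq_top ?_⟩⟩
    rw [Set.image_preimage_eq_of_subset (by simpa using ht), ← htop, span_deg_zero hR]
  · rintro ⟨t, ht⟩
    refine ⟨Submodule.fg_def.2 ⟨Subtype.val '' (t : Set (M.deg 0)), t.finite_toSet.image _, ?_⟩⟩
    rw [eq_top_iff, ← span_deg_zero hR M, Submodule.span_le]
    intro x hx
    have hxt : (⟨x, hx⟩ : M.deg 0) ∈ Submodule.span (𝓡 0) (t : Set (M.deg 0)) :=
      ht ▸ Submodule.mem_top
    obtain ⟨n, r, s, hrs⟩ := Submodule.mem_span_set'.1 hxt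
    have := congrArg Subtype.val hrs
    rw [AddSubmonoidClass.coe_finsetSum] at this
    change x ∈ Submodule.span R _
    rw [show x = _ from this.symm]
    exact sum_mem fun i _ => Submodule.smul_mem _ (r i : R)
      (Submodule.subset_span ⟨_, (s i).2, rfl⟩)

/-- The component of degree `0` of a linear lift is a lift in the category of graded modules. -/
theorem projective_of_projective_module [Module.Projective R M.carrier] : Projective M where
  factors {E X} f e _ := by
    obtain ⟨h, hh⟩ := Module.projective_lifting_property e.lin f.lin (surjective_of_epi e)
    refine ⟨⟨linComponent 0 h, fun hm => by simpa using linComponent_mem 0 h hm⟩, hom_ext ?_⟩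
    change e.lin ∘ₗ linComponent 0 h = f.lin
    rw [← linComponent_comp_hom, hh, linComponent_same]
    intro g m hm
    simpa using f.map_mem hm

theorem exists_free_epi (hR : IsStronglyGraded 𝓡) (M : GrMod 𝓡) :
    ∃ (I : Type u) (p : free 𝓡 I ⟶ M), Epi p := by
  obtain ⟨I, π, hπ⟩ := exists_free_degZero_range_eq (𝓡 := 𝓡) (⊤ : Submodule (𝓡 0) (M.deg 0))
  obtain ⟨p, hp⟩ := exists_extension hR π
  have := faithful_identityComponent hR
  refine ⟨I, p, (identityComponent 𝓡).epi_of_epi_map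
    ((ModuleCat.epi_iff_surjective _).2 fun m => ?_)⟩
  obtain ⟨x, hx⟩ := LinearMap.range_eq_top.1 hπ m
  exact ⟨x, Subtype.ext ((hp x).trans (congrArg Subtype.val hx))⟩

theorem projective_module_iff_projective (hR : IsStronglyGraded 𝓡) (M : GrMod 𝓡) :
    Module.Projective R M.carrier ↔ Projective M := by
  refine ⟨fun _ => projective_of_projective_module, fun _ => ?_⟩
  obtain ⟨I, p, _⟩ := exists_free_epi hR M
  refine Module.Projective.of_split (Projective.factorThru (𝟙 M) p).lin p.lin ?_
  exact congrArg (fun f => Hom.lin f) (Projective.factorThru_comp (𝟙 M) p)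

theorem projective_iff_projective_deg_zero (hR : IsStronglyGraded 𝓡) (M : GrMod 𝓡) :
    Module.Projective R M.carrier ↔ Module.Projective (𝓡 0) (M.deg 0) := by
  have := isEquivalence_identityComponent hR
  rw [projective_module_iff_projective hR, IsProjective.iff_projective]
  exact ((identityComponent 𝓡).asEquivalence.map_projective_iff M).symm

end GrMod

/-! ### Additive hulls -/

section AddHull

variable {C : Type*} [Category* C] [Preadditive C] [HasBinaryBiproducts C] [HasFiniteBiproducts C]
  {D : Type*} [Category* D] [Preadditive D] [HasBinaryBiproducts D] [HasFiniteBiproducts D]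

theorem addHull_mono {P P' : ObjectProperty C} (h : P ≤ P') : addHull P ≤ addHull P' := by
  rintro X ⟨n, Y, Z, hY, e⟩
  exact ⟨n, Y, Z, fun i => h _ (hY i), e⟩

theorem addHull_of_iso {P : ObjectProperty C} {X X' : C} (e : X ≅ X') (h : addHull P X) :
    addHull P X' := by
  obtain ⟨n, Y, Z, hY, ⟨e'⟩⟩ := h
  exact ⟨n, Y, Z, hY, ⟨biprod.mapIso e.symm (Iso.refl Z) ≪≫ e'⟩⟩

instance (P : ObjectProperty C) : (addHull P).IsClosedUnderIsomorphisms where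
  of_iso e h := addHull_of_iso e h

theorem addHull_of_fintype {P : ObjectProperty C} {ι : Type} [Finite ι] {X Z : C}
    (Y : ι → C) (hY : ∀ i, P (Y i)) (e : X ⊞ Z ≅ ⨁ Y) : addHull P X := by
  obtain ⟨n, ⟨s⟩⟩ := Finite.exists_equiv_fin ι
  exact ⟨n, Y ∘ s.symm, Z, fun i => hY _,
    ⟨e ≪≫ biproduct.whiskerEquiv s fun i => eqToIso (by simp)⟩⟩

/-- The biproduct of two finite direct sums, taken term by term. -/
noncomputable def biproductBiprodIso {ι : Type} [Finite ι] (Y Z : ι → C) :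
    (⨁ Y) ⊞ (⨁ Z) ≅ ⨁ fun i => Y i ⊞ Z i where
  hom := biprod.desc (biproduct.map fun _ => biprod.inl) (biproduct.map fun _ => biprod.inr)
  inv := biprod.lift (biproduct.map fun _ => biprod.fst) (biproduct.map fun _ => biprod.snd)

theorem addHull_addHull (P : ObjectProperty C) : addHull (addHull P) ≤ addHull P := by
  rintro X ⟨n, Y, Z, hY, ⟨e⟩⟩
  choose m W Z' hW e' using hY
  exact addHull_of_fintype (Z := Z ⊞ ⨁ Z') (fun p : Σ i, Fin (m i) => W p.1 p.2)
    (fun p => hW p.1 p.2)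
    ((biprod.associator X Z (⨁ Z')).symm ≪≫ biprod.mapIso e (Iso.refl _) ≪≫
      biproductBiprodIso Y Z' ≪≫ biproduct.mapIso (fun i => (e' i).some) ≪≫
      biproductBiproductIso (fun i => Fin (m i)) W)

theorem addHull_map (F : C ⥤ D) [F.Additive] {P : ObjectProperty C} {P' : ObjectProperty D}
    (h : ∀ X, P X → P' (F.obj X)) {X : C} (hX : addHull P X) : addHull P' (F.obj X) := by
  obtain ⟨n, Y, Z, hY, ⟨e⟩⟩ := hX
  have := preservesBinaryBiproducts_of_preservesBiproducts F
  exact ⟨n, F.obj ∘ Y, F.obj Z, fun i => h _ (hY i),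
    ⟨(F.mapBiprod X Z).symm ≪≫ F.mapIso e ≪≫ F.mapBiproduct Y⟩⟩

theorem addHull_isoClosure (P : ObjectProperty C) : addHull P.isoClosure ≤ addHull P := by
  rintro X ⟨n, Y, Z, hY, ⟨e⟩⟩
  choose Y' hY' e' using hY
  exact ⟨n, Y', Z, hY', ⟨e ≪≫ biproduct.mapIso fun i => (e' i).some⟩⟩

theorem addHull_obj_iff (Φ : C ⥤ D) [Φ.IsEquivalence] [Φ.Additive] {X₀ : C} {Y₀ : D}
    (e : Φ.obj X₀ ≅ Y₀) (X : C) :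
    addHull (fun Y => Y = Y₀) (Φ.obj X) ↔ addHull (fun Y => Y = X₀) X := by
  constructor
  · intro hX
    have : Φ.asEquivalence.functor.Additive := (inferInstance : Φ.Additive)
    have : Φ.asEquivalence.inverse.Additive := Φ.asEquivalence.inverse_additive
    refine addHull_of_iso (Φ.asEquivalence.unitIso.app X).symm (addHull_isoClosure _ _
      (addHull_map Φ.asEquivalence.inverse (P := fun Y => Y = Y₀) ?_ hX))
    rintro _ rfl
    exact ⟨X₀, rfl, ⟨Φ.asEquivalence.inverse.mapIso e.symm ≪≫
      (Φ.asEquivalence.unitIso.app X₀).symm⟩⟩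
  · intro hX
    refine addHull_isoClosure _ _ (addHull_map Φ (P := fun Y => Y = X₀) ?_ hX)
    rintro _ rfl
    exact ⟨Y₀, rfl, ⟨e⟩⟩

/-- The identity of a direct summand of a finite direct sum of copies of `X₀` is a finite sum of
maps that factor through `X₀`. -/
theorem exists_sum_comp_eq_id {X₀ X : C} (h : addHull (fun Y => Y = X₀) X) :
    ∃ (n : ℕ) (α : Fin n → (X ⟶ X₀)) (β : Fin n → (X₀ ⟶ X)), ∑ i, α i ≫ β i = 𝟙 X := by
  obtain ⟨n, Y, Z, hY, ⟨e⟩⟩ := h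
  obtain rfl : Y = fun _ => X₀ := funext hY
  refine ⟨n, fun i => biprod.inl ≫ e.hom ≫ biproduct.π _ i,
    fun i => biproduct.ι (fun _ => X₀) i ≫ e.inv ≫ biprod.fst, ?_⟩
  have : ∑ i, biproduct.π (fun _ : Fin n => X₀) i ≫ biproduct.ι (fun _ => X₀) i = 𝟙 _ :=
    biproduct.total
  calc _ = biprod.inl ≫ e.hom ≫
        (∑ i, biproduct.π (fun _ : Fin n => X₀) i ≫ biproduct.ι (fun _ => X₀) i) ≫
        e.inv ≫ biprod.fst := by
          simp only [Preadditive.comp_sum, Preadditive.sum_comp, Category.assoc]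
    _ = 𝟙 X := by rw [this]; simp

end AddHull

/-! ### Equivalences of triangulated categories -/

section Triangulated

variable {C : Type*} [Category* C] [HasZeroObject C] [HasShift C ℤ] [Preadditive C]
  [∀ n : ℤ, (shiftFunctor C n).Additive] [Pretriangulated C]
  {D : Type*} [Category* D] [HasZeroObject D] [HasShift D ℤ] [Preadditive D]
  [∀ n : ℤ, (shiftFunctor D n).Additive] [Pretriangulated D]

instance (P : ObjectProperty C) : (triangulatedHull P).IsClosedUnderIsomorphisms where
  of_iso e h Q hQ hQ' hP := Q.prop_of_iso e (h Q hQ hQ' hP)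

theorem triangulatedHull_map (Φ : C ⥤ D) [Φ.CommShift ℤ] [Φ.IsTriangulated]
    {P : ObjectProperty C} {P' : ObjectProperty D} (h : ∀ X, P X → P' (Φ.obj X)) {X : C}
    (hX : triangulatedHull P X) : triangulatedHull P' (Φ.obj X) := fun Q _ _ hQ =>
  hX (Q.inverseImage Φ) inferInstance inferInstance fun Y hY => hQ _ (h Y hY)

theorem triangulatedHull_obj_iff (Φ : C ⥤ D) [Φ.CommShift ℤ] [Φ.IsTriangulated]
    [Φ.IsEquivalence] {P : ObjectProperty C} [P.IsClosedUnderIsomorphisms] {P' : ObjectProperty D}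
    [P'.IsClosedUnderIsomorphisms] (h : ∀ X, P' (Φ.obj X) ↔ P X) (X : C) :
    triangulatedHull P' (Φ.obj X) ↔ triangulatedHull P X := by
  refine ⟨fun hX => ?_, triangulatedHull_map Φ fun X => (h X).2⟩
  let E := Φ.asEquivalence
  let : E.functor.CommShift ℤ := (inferInstance : Φ.CommShift ℤ)
  have : E.functor.IsTriangulated := (inferInstance : Φ.IsTriangulated)
  let := E.commShiftInverse ℤ
  have := E.commShift_of_functor ℤ
  have : E.inverse.IsTriangulated := E.toAdjunction.isTriangulated_rightAdjoint
  refine (triangulatedHull P).prop_of_iso (E.unitIso.app X).symm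
    (triangulatedHull_map E.inverse (P := P') (fun Y hY => (h _).1 ?_) hX)
  exact P'.prop_of_iso (E.counitIso.app Y).symm hY

end Triangulated

/-! ### Derived equivalences from equivalences of abelian categories -/

theorem isEquivalence_mapDerivedCategory {C D : Type*} [Category* C] [Abelian C] [Category* D]
    [Abelian D] [HasDerivedCategory.{w₁} C] [HasDerivedCategory.{w₂} D] (F : C ⥤ D) [F.Additive]
    [PreservesFiniteLimits F] [PreservesFiniteColimits F] [F.IsEquivalence] :
    F.mapDerivedCategory.IsEquivalence := by
  let Φ := F.mapHomologicalComplexUpToQuasiIsoLocalizerMorphism (ComplexShape.up ℤ)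
  have : F.asEquivalence.functor.PreservesZeroMorphisms :=
    inferInstanceAs F.PreservesZeroMorphisms
  have : Φ.functor.IsEquivalence :=
    (F.asEquivalence.mapHomologicalComplex (ComplexShape.up ℤ)).isEquivalence_functor
  have : Φ.IsInduced := ⟨by
    ext K L f
    exact HomologicalComplex.quasiIso_map_iff_of_preservesHomology f F⟩
  have := Φ.isLocalizedEquivalence_of_isInduced
  let : CatCommSq Φ.functor DerivedCategory.Q DerivedCategory.Q F.mapDerivedCategory :=
    ⟨F.mapDerivedCategoryFactors.symm⟩
  exact Φ.isEquivalence DerivedCategory.Q DerivedCategory.Q F.mapDerivedCategory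

/-! ### Tilting complexes and the identity component -/

theorem CategoryTheory.Functor.isZero_obj_iff {C D : Type*} [Category* C] [Category* D]
    [HasZeroMorphisms C] [HasZeroMorphisms D] (F : C ⥤ D) [F.Faithful]
    [F.PreservesZeroMorphisms] (X : C) : IsZero (F.obj X) ↔ IsZero X := by
  rw [IsZero.iff_id_eq_zero, IsZero.iff_id_eq_zero]
  refine ⟨fun h => F.map_injective ?_, fun h => ?_⟩
  · rw [F.map_id, h, F.map_zero]
  · rw [← F.map_id, h, F.map_zero]

theorem IsPerfect.of_iso {A : Type u} [Ring A] {K L : CochainComplex (ModuleCat.{u} A) ℤ}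
    (hK : IsPerfect K) (e : K ≅ L) : IsPerfect L := by
  have e' : ∀ i, K.X i ≅ L.X i := fun i => (HomologicalComplex.eval _ _ i).mapIso e
  obtain ⟨a, b, hab⟩ := hK.bounded
  have := hK.finite
  have := hK.projective
  exact ⟨⟨a, b, fun i hi => (hab i hi).of_iso (e' i).symm⟩,
    fun i => Module.Finite.equiv (e' i).toLinearEquiv,
    fun i => Module.Projective.of_equiv (e' i).toLinearEquiv⟩

/-- Self-extensions are detected by a fully faithful functor that commutes with the shift. -/
theorem forall_shiftedHom_eq_zero_iff {C D : Type*} [Category* C] [Category* D] [Preadditive C]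
    [Preadditive D] [HasShift C ℤ] [HasShift D ℤ] (Φ : C ⥤ D) [Φ.Full] [Φ.Faithful] [Φ.Additive]
    [Φ.CommShift ℤ] {X : C} {Y : D} (e : Φ.obj X ≅ Y) (n : ℤ) :
    (∀ f : Y ⟶ (shiftFunctor D n).obj Y, f = 0) ↔ ∀ f : X ⟶ (shiftFunctor C n).obj X, f = 0 := by
  constructor
  · intro h f
    have h1 := h (e.inv ≫ Φ.map f ≫ (Φ.commShiftIso n).hom.app X ≫ (shiftFunctor D n).map e.hom)
    apply Φ.map_injective
    rw [← cancel_mono ((Φ.commShiftIso n).hom.app X ≫ (shiftFunctor D n).map e.hom),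
      ← cancel_epi e.inv, h1]
    simp
  · intro h f
    obtain ⟨f', hf'⟩ := Φ.map_surjective
      (e.hom ≫ f ≫ (shiftFunctor D n).map e.inv ≫ (Φ.commShiftIso n).inv.app X)
    rw [h f', Φ.map_zero] at hf'
    rw [← cancel_mono ((shiftFunctor D n).map e.inv ≫ (Φ.commShiftIso n).inv.app X),
      ← cancel_epi e.hom, ← hf']
    simp

section

variable {G : Type v} [AddGroup G] [DecidableEq G] {R : Type u} [Ring R] {𝓡 : G → AddSubgroup R}

namespace GrMod

instance : (forget 𝓡).Faithful where
  map_injective h := hom_ext (congrArg ModuleCat.Hom.hom h)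

/-- The suspension by `0` does nothing. -/
def suspensionZeroIso (M : GrMod 𝓡) : (suspension 𝓡 0).obj M ≅ M where
  hom := ⟨LinearMap.id, fun {g m} hm => by
    change m ∈ M.deg (g + 0) at hm
    rwa [add_zero] at hm⟩
  inv := ⟨LinearMap.id, fun {g m} hm => by
    change m ∈ M.deg (g + 0)
    rwa [add_zero]⟩

end GrMod

/-- The suspension by `0` does nothing to complexes. -/
def suspensionComplexZeroIso (T : CochainComplex (GrMod 𝓡) ℤ) : suspensionComplex 0 T ≅ T :=
  HomologicalComplex.Hom.isoOfComponents (fun i => GrMod.suspensionZeroIso (T.X i))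
    (fun _ _ _ => rfl)

theorem isPerfect_identityComponentComplex_iff [GradedRing 𝓡] (hR : IsStronglyGraded 𝓡)
    (T : CochainComplex (GrMod 𝓡) ℤ) :
    IsPerfect (identityComponentComplex T) ↔ IsPerfect (forgetComplex T) := by
  have := GrMod.isEquivalence_identityComponent hR
  have hb : IsBoundedComplex (identityComponentComplex T) ↔ IsBoundedComplex (forgetComplex T) :=
    exists_congr fun a => exists_congr fun b => forall_congr' fun i => imp_congr_right fun _ =>
      ((GrMod.identityComponent 𝓡).isZero_obj_iff (T.X i)).trans
        ((GrMod.forget 𝓡).isZero_obj_iff (T.X i)).symm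
  exact ⟨fun h => ⟨hb.1 h.bounded, fun i => (GrMod.finite_iff_finite_deg_zero hR _).2 (h.finite i),
      fun i => (GrMod.projective_iff_projective_deg_zero hR _).2 (h.projective i)⟩,
    fun h => ⟨hb.2 h.bounded, fun i => (GrMod.finite_iff_finite_deg_zero hR _).1 (h.finite i),
      fun i => (GrMod.projective_iff_projective_deg_zero hR _).1 (h.projective i)⟩⟩

instance [HasDerivedCategory.{w₁} (GrMod 𝓡)] : (grperf 𝓡).IsClosedUnderIsomorphisms where
  of_iso := by
    rintro X Y e ⟨K, hK, ⟨e'⟩⟩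
    exact ⟨K, hK, ⟨e.symm ≪≫ e'⟩⟩

instance [HasDerivedCategory.{w₁} (ModuleCat.{u} R)] : (perf R).IsClosedUnderIsomorphisms where
  of_iso := by
    rintro X Y e ⟨K, hK, ⟨e'⟩⟩
    exact ⟨K, hK, ⟨e.symm ≪≫ e'⟩⟩

/-- A weakly invariant complex is weakly invariant in the derived category. -/
theorem IsWeaklyGInvariant.addHull_Q [HasDerivedCategory.{w₁} (GrMod 𝓡)]
    {T : CochainComplex (GrMod 𝓡) ℤ} (hT : IsWeaklyGInvariant T) (g : G) :
    addHull (fun X => X = DerivedCategory.Q.obj T)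
      (DerivedCategory.Q.obj (suspensionComplex g T)) := by
  refine addHull_of_iso ((DerivedCategory.quotientCompQhIso _).app _) (addHull_isoClosure _ _
    (addHull_map DerivedCategory.Qh
      (P := fun X => X = (HomotopyCategory.quotient (GrMod 𝓡) (ComplexShape.up ℤ)).obj T) ?_
      (hT g)))
  rintro _ rfl
  exact ⟨_, rfl, ⟨(DerivedCategory.quotientCompQhIso _).app T⟩⟩

/-- For a weakly invariant complex, the suspensions have the same additive hull as the complex. -/
theorem IsWeaklyGInvariant.addHull_eq [HasDerivedCategory.{w₁} (GrMod 𝓡)]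
    {T : CochainComplex (GrMod 𝓡) ℤ} (hT : IsWeaklyGInvariant T) :
    addHull (fun X => ∃ g : G, X = DerivedCategory.Q.obj (suspensionComplex g T)) =
      addHull (fun X => X = DerivedCategory.Q.obj T) := by
  apply le_antisymm
  · refine (addHull_mono ?_).trans (addHull_addHull _)
    rintro _ ⟨g, rfl⟩
    exact hT.addHull_Q g
  · refine (addHull_mono ?_).trans (addHull_isoClosure _)
    rintro _ rfl
    exact ⟨_, ⟨0, rfl⟩, ⟨DerivedCategory.Q.mapIso (suspensionComplexZeroIso T).symm⟩⟩

theorem IsWeaklyGInvariant.isTiltingComplex_iff [GradedRing 𝓡] (hR : IsStronglyGraded 𝓡)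
    [HasDerivedCategory.{w₁} (GrMod 𝓡)] [HasDerivedCategory.{w₃} (ModuleCat.{u} (𝓡 0))]
    {T : CochainComplex (GrMod 𝓡) ℤ} (hT : IsWeaklyGInvariant T) :
    IsTiltingComplex (identityComponentComplex T) ↔ IsGradedTiltingComplex T := by
  have := GrMod.isEquivalence_identityComponent hR
  let Φ := (GrMod.identityComponent 𝓡).mapDerivedCategory
  have : Φ.IsEquivalence := isEquivalence_mapDerivedCategory _
  have hfac : ∀ K : CochainComplex (GrMod 𝓡) ℤ, Nonempty (Φ.obj (DerivedCategory.Q.obj K) ≅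
      DerivedCategory.Q.obj (identityComponentComplex K)) := fun K =>
    ⟨(GrMod.identityComponent 𝓡).mapDerivedCategoryFactors.app K⟩
  obtain ⟨e⟩ := hfac T
  have hperf : ∀ X, perf (𝓡 0) (Φ.obj X) ↔ grperf 𝓡 X := by
    intro X
    constructor
    · rintro ⟨L, hL, ⟨e₁⟩⟩
      have : ((GrMod.identityComponent 𝓡).mapHomologicalComplex (ComplexShape.up ℤ)).EssSurj :=
        ((GrMod.identityComponent 𝓡).asEquivalence.mapHomologicalComplex
          (ComplexShape.up ℤ)).essSurj_functor
      let K := Functor.objPreimage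
        ((GrMod.identityComponent 𝓡).mapHomologicalComplex (ComplexShape.up ℤ)) L
      have e₂ : identityComponentComplex K ≅ L := Functor.objObjPreimageIso _ L
      exact ⟨K, (isPerfect_identityComponentComplex_iff hR K).1 (hL.of_iso e₂.symm),
        ⟨Φ.preimageIso (e₁ ≪≫ DerivedCategory.Q.mapIso e₂.symm ≪≫ (hfac K).some.symm)⟩⟩
    · rintro ⟨K, hK, ⟨e₁⟩⟩
      exact ⟨_, (isPerfect_identityComponentComplex_iff hR K).2 hK,
        ⟨Φ.mapIso e₁ ≪≫ (hfac K).some⟩⟩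
  have hhom := fun n => forall_shiftedHom_eq_zero_iff Φ e n
  have hhull : ∀ X, triangulatedHull (addHull (fun X => X =
      DerivedCategory.Q.obj (identityComponentComplex T))) (Φ.obj X) ↔
      triangulatedHull (addHull (fun X => X = DerivedCategory.Q.obj T)) X :=
    triangulatedHull_obj_iff Φ (addHull_obj_iff Φ e)
  constructor
  · intro h
    refine ⟨(isPerfect_identityComponentComplex_iff hR T).1 h.perfect, fun g n hn f => ?_, ?_⟩
    · obtain ⟨m, α, β, hαβ⟩ := exists_sum_comp_eq_id (hT.addHull_Q g)
      -- `f` is a sum of maps that factor through morphisms from `T` to `T[n]`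
      rw [← Category.comp_id f, ← (shiftFunctor _ n).map_id, ← hαβ, Functor.map_sum,
        Preadditive.comp_sum]
      refine Finset.sum_eq_zero fun i _ => ?_
      rw [Functor.map_comp, ← Category.assoc, (hhom n).1 (h.hom_eq_zero n hn) (f ≫ _), zero_comp]
    · rw [hT.addHull_eq]
      ext X
      rw [← hhull, h.generates, hperf]
  · intro h
    refine ⟨(isPerfect_identityComponentComplex_iff hR T).2 h.perfect, fun n hn => ?_, ?_⟩
    · refine (hhom n).2 fun f => ?_
      let e₀ := DerivedCategory.Q.mapIso (suspensionComplexZeroIso T)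
      rw [← cancel_mono ((shiftFunctor _ n).map e₀.inv), zero_comp]
      exact h.hom_eq_zero 0 n hn _
    · have hg := h.generates
      rw [hT.addHull_eq] at hg
      ext Y
      have e₁ := Φ.objObjPreimageIso Y
      rw [← (triangulatedHull _).prop_iff_of_iso e₁, ← (perf (𝓡 0)).prop_iff_of_iso e₁, hhull, hg,
        hperf]

end

/-! ### Morphisms from bounded complexes of projectives in the derived category -/

section KProjective

variable {C : Type*} [Category* C] [Abelian C] [HasDerivedCategory.{w₁} C]

theorem DerivedCategory.Q_map_eq_of_quotient_map_eq {K L : CochainComplex C ℤ} {f f' : K ⟶ L}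
    (h : (HomotopyCategory.quotient C (ComplexShape.up ℤ)).map f =
      (HomotopyCategory.quotient C (ComplexShape.up ℤ)).map f') :
    DerivedCategory.Q.map f = DerivedCategory.Q.map f' := by
  have := congrArg (fun q => DerivedCategory.Qh.map q) h
  rw [← cancel_epi ((quotientCompQhIso C).hom.app K)]
  exact ((quotientCompQhIso C).hom.naturality f).symm.trans
    ((congrArg (· ≫ _) this).trans ((quotientCompQhIso C).hom.naturality f'))

theorem CochainComplex.IsKProjective.Q_map_surjective {K L : CochainComplex C ℤ}
    [K.IsKProjective] :
    Function.Surjective ((DerivedCategory.Q (C := C)).map (X := K) (Y := L)) := by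
  intro x
  let e := DerivedCategory.quotientCompQhIso C
  obtain ⟨y, hy⟩ := (CochainComplex.IsKProjective.Qh_map_bijective K
    ((HomotopyCategory.quotient _ _).obj L)).surjective (e.hom.app K ≫ x ≫ e.inv.app L)
  obtain ⟨f, rfl⟩ := (HomotopyCategory.quotient C (ComplexShape.up ℤ)).map_surjective y
  refine ⟨f, ?_⟩
  have h := e.hom.naturality f
  rw [← cancel_epi (e.hom.app K), ← h]
  refine (congrArg (· ≫ e.hom.app L) hy).trans ?_
  simp

theorem CochainComplex.IsKProjective.quotient_map_eq {K L : CochainComplex C ℤ}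
    [K.IsKProjective] {f f' : K ⟶ L} (h : DerivedCategory.Q.map f = DerivedCategory.Q.map f') :
    (HomotopyCategory.quotient C (ComplexShape.up ℤ)).map f =
      (HomotopyCategory.quotient C (ComplexShape.up ℤ)).map f' := by
  let e := DerivedCategory.quotientCompQhIso C
  apply (CochainComplex.IsKProjective.Qh_map_bijective K _).injective
  rw [← cancel_mono (e.hom.app L)]
  exact (e.hom.naturality f).trans ((congrArg (_ ≫ ·) h).trans (e.hom.naturality f').symm)

omit [HasDerivedCategory.{w₁} C] in
theorem IsBoundedComplex.isKProjective {K : CochainComplex C ℤ} (hK : IsBoundedComplex K)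
    (h : ∀ i, Projective (K.X i)) :
    K.IsKProjective := by
  obtain ⟨a, b, hab⟩ := hK
  have : K.IsStrictlyLE b := by
    rw [CochainComplex.isStrictlyLE_iff]
    exact fun i hi => hab i (Or.inr hi)
  exact CochainComplex.isKProjective_of_projective K b

end KProjective

/-! ### Homogeneous maps between complexes of graded modules -/

section Homogeneous

variable {G : Type v} [AddGroup G] [DecidableEq G] {R : Type u} [Ring R] {𝓡 : G → AddSubgroup R}
  {K L N : CochainComplex (GrMod 𝓡) ℤ}

/-- A map `φ` between the underlying complexes of `R`-modules is homogeneous of degree `g` if it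
maps elements of degree `k` to elements of degree `k + g`. -/
def IsHomogeneousHom (g : G) (φ : forgetComplex K ⟶ forgetComplex L) : Prop :=
  ∀ (i : ℤ) (k : G), ∀ m ∈ (K.X i).deg k, (φ.f i).hom m ∈ (L.X i).deg (k + g)

theorem IsHomogeneousHom.comp {g h : G} {φ : forgetComplex K ⟶ forgetComplex L}
    {ψ : forgetComplex L ⟶ forgetComplex N} (hφ : IsHomogeneousHom g φ)
    (hψ : IsHomogeneousHom h ψ) : IsHomogeneousHom (g + h) (φ ≫ ψ) := fun i k m hm => by
  rw [← add_assoc]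
  exact hψ i _ _ (hφ i k m hm)

theorem isHomogeneousHom_map (f : K ⟶ L) :
    IsHomogeneousHom 0
      (((GrMod.forget 𝓡).mapHomologicalComplex (ComplexShape.up ℤ)).map f) := fun i k m hm => by
  rw [add_zero]
  exact (f.f i).map_mem hm

theorem isHomogeneousHom_forgetSuspensionIso_hom (g : G) (T : CochainComplex (GrMod 𝓡) ℤ) :
    IsHomogeneousHom g (forgetSuspensionIso g T).hom := fun _ _ _ hm => hm

theorem isHomogeneousHom_forgetSuspensionIso_inv (g : G) (T : CochainComplex (GrMod 𝓡) ℤ) :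
    IsHomogeneousHom (-g) (forgetSuspensionIso g T).inv := fun i k m hm => by
  change m ∈ (T.X i).deg (k + -g + g)
  rwa [neg_add_cancel_right]

/-- The maps of degree `0` are the maps of complexes of graded modules. -/
theorem IsHomogeneousHom.exists_map_eq {φ : forgetComplex K ⟶ forgetComplex L}
    (hφ : IsHomogeneousHom 0 φ) :
    ∃ f : K ⟶ L, ((GrMod.forget 𝓡).mapHomologicalComplex (ComplexShape.up ℤ)).map f = φ := by
  refine ⟨{ f := fun i => ⟨(φ.f i).hom, fun {k m} hm => ?_⟩, comm' := fun i j _ => ?_ }, ?_⟩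
  · have := hφ i k m hm
    rwa [add_zero] at this
  · exact (GrMod.forget 𝓡).map_injective (φ.comm i j)
  · ext i : 1
    rfl

section

variable {T : CochainComplex (GrMod 𝓡) ℤ}

theorem quotient_map_forget_eq {f f' : K ⟶ L}
    (h : (HomotopyCategory.quotient _ (ComplexShape.up ℤ)).map f =
      (HomotopyCategory.quotient _ (ComplexShape.up ℤ)).map f') :
    (HomotopyCategory.quotient _ (ComplexShape.up ℤ)).map
        (((GrMod.forget 𝓡).mapHomologicalComplex (ComplexShape.up ℤ)).map f) =
      (HomotopyCategory.quotient _ (ComplexShape.up ℤ)).map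
        (((GrMod.forget 𝓡).mapHomologicalComplex (ComplexShape.up ℤ)).map f') :=
  HomotopyCategory.eq_of_homotopy _ _
    ((GrMod.forget 𝓡).mapHomotopy (HomotopyCategory.homotopyOfEq _ _ h))

/-- The endomorphism of `T` of degree `g` given by a map `T ⟶ T(g)`. -/
def ofHomToSuspension {g : G} (b : T ⟶ suspensionComplex g T) :
    forgetComplex T ⟶ forgetComplex T :=
  ((GrMod.forget 𝓡).mapHomologicalComplex (ComplexShape.up ℤ)).map b ≫
    (forgetSuspensionIso g T).hom

/-- The endomorphism of `T` of degree `-g` given by a map `T(g) ⟶ T`. -/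
def ofHomFromSuspension {g : G} (a : suspensionComplex g T ⟶ T) :
    forgetComplex T ⟶ forgetComplex T :=
  (forgetSuspensionIso g T).inv ≫
    ((GrMod.forget 𝓡).mapHomologicalComplex (ComplexShape.up ℤ)).map a

theorem isHomogeneousHom_ofHomToSuspension {g : G} (b : T ⟶ suspensionComplex g T) :
    IsHomogeneousHom g (ofHomToSuspension b) := by
  have h := (isHomogeneousHom_map b).comp (isHomogeneousHom_forgetSuspensionIso_hom g T)
  rwa [zero_add] at h

theorem isHomogeneousHom_ofHomFromSuspension {g : G} (a : suspensionComplex g T ⟶ T) :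
    IsHomogeneousHom (-g) (ofHomFromSuspension a) := by
  have h := (isHomogeneousHom_forgetSuspensionIso_inv g T).comp (isHomogeneousHom_map a)
  rwa [add_zero] at h

/-- Every endomorphism of degree `g` comes from a map `T ⟶ T(g)`. -/
theorem IsHomogeneousHom.exists_ofHomToSuspension_eq {g : G}
    {φ : forgetComplex T ⟶ forgetComplex T} (hφ : IsHomogeneousHom g φ) :
    ∃ b : T ⟶ suspensionComplex g T, ofHomToSuspension b = φ := by
  have h := hφ.comp (isHomogeneousHom_forgetSuspensionIso_inv g T)
  rw [add_neg_cancel] at h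
  obtain ⟨b, hb⟩ := h.exists_map_eq
  refine ⟨b, ?_⟩
  rw [ofHomToSuspension, hb, Category.assoc, Iso.inv_hom_id, Category.comp_id]

/-- Every endomorphism of degree `-g` comes from a map `T(g) ⟶ T`. -/
theorem IsHomogeneousHom.exists_ofHomFromSuspension_eq {g : G}
    {ψ : forgetComplex T ⟶ forgetComplex T} (hψ : IsHomogeneousHom (-g) ψ) :
    ∃ a : suspensionComplex g T ⟶ T, ofHomFromSuspension a = ψ := by
  have h := (isHomogeneousHom_forgetSuspensionIso_hom g T).comp hψ
  rw [add_neg_cancel] at h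
  obtain ⟨a, ha⟩ := h.exists_map_eq
  refine ⟨a, ?_⟩
  rw [ofHomFromSuspension, ha, Iso.inv_hom_id_assoc]

end

theorem isKProjective_forgetComplex {T : CochainComplex (GrMod 𝓡) ℤ}
    (hT : IsPerfect (forgetComplex T)) :
    (forgetComplex T).IsKProjective := by
  refine hT.bounded.isKProjective fun i => ?_
  have := hT.projective i
  exact (IsProjective.iff_projective _).1 this

variable [GradedRing 𝓡]

/-- The component of degree `g` of a map between the underlying complexes of `R`-modules. -/
noncomputable def homComponent (g : G) (φ : forgetComplex K ⟶ forgetComplex L) :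
    forgetComplex K ⟶ forgetComplex L where
  f i := ModuleCat.ofHom (GrMod.linComponent (M := K.X i) (N := L.X i) g (φ.f i).hom)
  comm' i j _ := by
    have h : (L.d i j).lin ∘ₗ (φ.f i).hom = (φ.f j).hom ∘ₗ (K.d i j).lin :=
      congrArg ModuleCat.Hom.hom (φ.comm i j)
    exact ModuleCat.hom_ext ((GrMod.linComponent_comp_hom g _ (L.d i j)).symm.trans
      ((congrArg (GrMod.linComponent g) h).trans (GrMod.linComponent_hom_comp g (K.d i j) _)))

theorem isHomogeneousHom_homComponent (g : G) (φ : forgetComplex K ⟶ forgetComplex L) :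
    IsHomogeneousHom g (homComponent g φ) := fun _ _ _ hm => GrMod.linComponent_mem g _ hm

theorem homComponent_add (g : G) (φ ψ : forgetComplex K ⟶ forgetComplex L) :
    homComponent g (φ + ψ) = homComponent g φ + homComponent g ψ := by
  ext i : 2
  exact GrMod.linComponent_add g _ _

theorem IsHomogeneousHom.homComponent_same {g : G} {φ : forgetComplex K ⟶ forgetComplex L}
    (hφ : IsHomogeneousHom g φ) : homComponent g φ = φ := by
  ext i : 2
  exact GrMod.linComponent_same (hφ i)

theorem IsHomogeneousHom.homComponent_ne {g h : G} (hne : h ≠ g)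
    {φ : forgetComplex K ⟶ forgetComplex L} (hφ : IsHomogeneousHom h φ) :
    homComponent g φ = 0 := by
  ext i : 2
  exact GrMod.linComponent_ne hne (hφ i)

/-- The component of degree `g` of a homotopy: taking components commutes with the composition with
the differentials, which are homogeneous of degree `0`. -/
noncomputable def homotopyComponent (g : G) {φ ψ : forgetComplex K ⟶ forgetComplex L}
    (h : Homotopy φ ψ) : Homotopy (homComponent g φ) (homComponent g ψ) where
  hom i j := ModuleCat.ofHom (GrMod.linComponent (M := K.X i) (N := L.X j) g (h.hom i j).hom)
  zero i j hij := by
    rw [h.zero i j hij]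
    exact ModuleCat.hom_ext (GrMod.linComponent_zero (M := K.X i) (N := L.X j) g)
  comm i := by
    have hi : (ComplexShape.up ℤ).Rel (i - 1) i := by simp
    have h1 := congrArg ModuleCat.Hom.hom (h.comm i)
    rw [dNext_eq _ (show (ComplexShape.up ℤ).Rel i (i + 1) from rfl), prevD_eq _ hi] at h1
    refine Eq.trans ?_ (congrArg₂ (· + ·) (congrArg₂ (· + ·)
      (dNext_eq _ (show (ComplexShape.up ℤ).Rel i (i + 1) from rfl)).symm
      (prevD_eq _ hi).symm) rfl)
    refine ModuleCat.hom_ext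
      ((congrArg (GrMod.linComponent (M := K.X i) (N := L.X i) g) h1).trans ?_)
    refine (GrMod.linComponent_add g _ _).trans (congrArg₂ (· + ·) ?_ rfl)
    refine (GrMod.linComponent_add g _ _).trans (congrArg₂ (· + ·) ?_ ?_)
    · exact GrMod.linComponent_hom_comp g (K.d i (i + 1)) _
    · exact GrMod.linComponent_comp_hom g _ (L.d (i - 1) i)

theorem quotient_map_homComponent_eq (g : G) {φ ψ : forgetComplex K ⟶ forgetComplex L}
    (h : (HomotopyCategory.quotient _ (ComplexShape.up ℤ)).map φ =
      (HomotopyCategory.quotient _ (ComplexShape.up ℤ)).map ψ) :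
    (HomotopyCategory.quotient _ (ComplexShape.up ℤ)).map (homComponent g φ) =
      (HomotopyCategory.quotient _ (ComplexShape.up ℤ)).map (homComponent g ψ) :=
  HomotopyCategory.eq_of_homotopy _ _ (homotopyComponent g (HomotopyCategory.homotopyOfEq _ _ h))

/-- Maps of complexes of graded modules that are homotopic over `R` are homotopic as maps of
complexes of graded modules, through the component of degree `0` of a homotopy. -/
theorem quotient_map_eq_of_forget {f f' : K ⟶ L}
    (h : (HomotopyCategory.quotient _ (ComplexShape.up ℤ)).map
        (((GrMod.forget 𝓡).mapHomologicalComplex (ComplexShape.up ℤ)).map f) =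
      (HomotopyCategory.quotient _ (ComplexShape.up ℤ)).map
        (((GrMod.forget 𝓡).mapHomologicalComplex (ComplexShape.up ℤ)).map f')) :
    (HomotopyCategory.quotient _ (ComplexShape.up ℤ)).map f =
      (HomotopyCategory.quotient _ (ComplexShape.up ℤ)).map f' := by
  let s := homotopyComponent 0 (HomotopyCategory.homotopyOfEq _ _ h)
  let t (i j : ℤ) : K.X i ⟶ L.X j :=
    ⟨(s.hom i j).hom, fun {k m} hm => by
      have := GrMod.linComponent_mem (M := K.X i) (N := L.X j) 0
        ((HomotopyCategory.homotopyOfEq _ _ h).hom i j).hom hm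
      rwa [add_zero] at this⟩
  refine HomotopyCategory.eq_of_homotopy _ _
    { hom := t
      zero := fun i j hij => (GrMod.forget 𝓡).map_injective (s.zero i j hij)
      comm := fun i => (GrMod.forget 𝓡).map_injective ?_ }
  have hi : (ComplexShape.up ℤ).Rel (i - 1) i := by simp
  have h1 := s.comm i
  rw [dNext_eq _ (show (ComplexShape.up ℤ).Rel i (i + 1) from rfl), prevD_eq _ hi] at h1 ⊢
  exact (congrArg (fun q => q.f i) (isHomogeneousHom_map f).homComponent_same.symm).trans
    (h1.trans (congrArg (fun q => _ + q.f i) (isHomogeneousHom_map f').homComponent_same))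

/-- A map between bounded complexes with finitely generated terms is the sum of finitely many
homogeneous components. -/
theorem exists_sum_homComponent (hK : IsPerfect (forgetComplex K))
    (φ : forgetComplex K ⟶ forgetComplex L) :
    ∃ s : Finset G, φ = ∑ g ∈ s, homComponent g φ := by
  obtain ⟨a, b, hab⟩ := hK.bounded
  have hfin (i : ℤ) : Module.Finite R (K.X i).carrier := hK.finite i
  choose s hs using fun i =>
    GrMod.exists_forall_sum_linComponent (M := K.X i) (N := L.X i) (φ.f i).hom
  refine ⟨(Finset.Icc a b).biUnion s, ?_⟩
  ext i : 1
  by_cases hi : i < a ∨ b < i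
  · exact (hab i hi).eq_of_src _ _
  · have hi' : i ∈ Finset.Icc a b := by
      rw [Finset.mem_Icc]
      omega
    have hsum := (HomologicalComplex.eval (ModuleCat R) (ComplexShape.up ℤ) i).map_sum
      (fun g => homComponent g φ) ((Finset.Icc a b).biUnion s)
    refine Eq.trans (ModuleCat.hom_ext ?_) hsum.symm
    exact (hs i _ (Finset.subset_biUnion_of_mem s hi')).trans
      (ModuleCat.hom_sum (fun g => (homComponent g φ).f i) _).symm

theorem isKProjective_of_isPerfect {T : CochainComplex (GrMod 𝓡) ℤ} (hb : IsBoundedComplex T)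
    (hT : IsPerfect (forgetComplex T)) : T.IsKProjective := by
  refine hb.isKProjective fun i => ?_
  have : Module.Projective R (T.X i).carrier := hT.projective i
  exact GrMod.projective_of_projective_module

end Homogeneous

/-! ### The graded endomorphism ring -/

section EndOp

variable {G : Type v} [AddGroup G] [DecidableEq G] {R : Type u} [Ring R] {𝓡 : G → AddSubgroup R}
  [HasDerivedCategory.{w₂} (ModuleCat.{u} R)] {T : CochainComplex (GrMod 𝓡) ℤ}

/-- The element of `End_{D(R)}(T)ᵒᵖ` given by a map of complexes. Products in this ring are
composites in diagrammatic order. -/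
noncomputable def toEndOp (φ : forgetComplex T ⟶ forgetComplex T) : EndOp T :=
  MulOpposite.op (DerivedCategory.Q.map φ)

theorem toEndOp_comp (φ ψ : forgetComplex T ⟶ forgetComplex T) :
    toEndOp (φ ≫ ψ) = toEndOp φ * toEndOp ψ :=
  congrArg MulOpposite.op (DerivedCategory.Q.map_comp φ ψ)

theorem toEndOp_id : toEndOp (𝟙 (forgetComplex T)) = 1 :=
  congrArg MulOpposite.op (DerivedCategory.Q.map_id _)

theorem toEndOp_add (φ ψ : forgetComplex T ⟶ forgetComplex T) :
    toEndOp (φ + ψ) = toEndOp φ + toEndOp ψ :=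
  congrArg MulOpposite.op (DerivedCategory.Q.map_add)

theorem toEndOp_zero : toEndOp (0 : forgetComplex T ⟶ forgetComplex T) = 0 :=
  congrArg MulOpposite.op (DerivedCategory.Q.map_zero _ _)

theorem toEndOp_sum {ι : Type*} (s : Finset ι) (φ : ι → (forgetComplex T ⟶ forgetComplex T)) :
    toEndOp (∑ i ∈ s, φ i) = ∑ i ∈ s, toEndOp (φ i) :=
  map_sum (AddMonoidHom.mk' toEndOp toEndOp_add) φ s

theorem toEndOp_surjective (hT : IsPerfect (forgetComplex T)) (x : EndOp T) :
    ∃ φ : forgetComplex T ⟶ forgetComplex T, toEndOp φ = x := by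
  have := isKProjective_forgetComplex hT
  obtain ⟨φ, hφ⟩ := CochainComplex.IsKProjective.Q_map_surjective
    (K := forgetComplex T) (L := forgetComplex T) x.unop
  exact ⟨φ, congrArg MulOpposite.op hφ⟩

theorem toEndOp_eq_of_quotient_map_eq {φ ψ : forgetComplex T ⟶ forgetComplex T}
    (h : (HomotopyCategory.quotient _ (ComplexShape.up ℤ)).map φ =
      (HomotopyCategory.quotient _ (ComplexShape.up ℤ)).map ψ) : toEndOp φ = toEndOp ψ :=
  congrArg MulOpposite.op (DerivedCategory.Q_map_eq_of_quotient_map_eq h)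

theorem quotient_map_eq_of_toEndOp_eq (hT : IsPerfect (forgetComplex T))
    {φ ψ : forgetComplex T ⟶ forgetComplex T} (h : toEndOp φ = toEndOp ψ) :
    (HomotopyCategory.quotient _ (ComplexShape.up ℤ)).map φ =
      (HomotopyCategory.quotient _ (ComplexShape.up ℤ)).map ψ := by
  have := isKProjective_forgetComplex hT
  exact CochainComplex.IsKProjective.quotient_map_eq (congrArg MulOpposite.unop h)

/-- If the identity of `T(g)` is homotopic to a sum of maps `T(g) ⟶ T ⟶ T(g)`, then `1` is the
sum of the corresponding products of elements of degrees `-g` and `g`. -/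
theorem sum_toEndOp_mul_toEndOp_eq_one {ι : Type*} (s : Finset ι) {g : G}
    (a : ι → (suspensionComplex g T ⟶ T)) (b : ι → (T ⟶ suspensionComplex g T))
    (h : (HomotopyCategory.quotient _ (ComplexShape.up ℤ)).map (∑ i ∈ s, a i ≫ b i) =
      (HomotopyCategory.quotient _ (ComplexShape.up ℤ)).map (𝟙 (suspensionComplex g T))) :
    ∑ i ∈ s, toEndOp (ofHomFromSuspension (a i)) * toEndOp (ofHomToSuspension (b i)) = 1 := by
  have key : ∑ i ∈ s, ofHomFromSuspension (a i) ≫ ofHomToSuspension (b i) =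
      (forgetSuspensionIso g T).inv ≫
        ((GrMod.forget 𝓡).mapHomologicalComplex (ComplexShape.up ℤ)).map (∑ i ∈ s, a i ≫ b i) ≫
        (forgetSuspensionIso g T).hom := by
    simp only [ofHomFromSuspension, ofHomToSuspension, Functor.map_sum, Functor.map_comp,
      Preadditive.sum_comp, Preadditive.comp_sum, Category.assoc]
  simp only [← toEndOp_comp]
  rw [← toEndOp_sum, key, ← toEndOp_id]
  apply toEndOp_eq_of_quotient_map_eq
  rw [Functor.map_comp, Functor.map_comp, quotient_map_forget_eq h, ← Functor.map_comp,
    ← Functor.map_comp, CategoryTheory.Functor.map_id, Category.id_comp, Iso.inv_hom_id]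

section

variable [GradedRing 𝓡]

/-- The projection of `End_{D(R)}(T)ᵒᵖ` on its component of degree `g`: the class of the component
of degree `g` of a representing map of complexes. It does not depend on the chosen representative,
because homotopies have components as well. -/
noncomputable def endOpProj (hT : IsPerfect (forgetComplex T)) (g : G) : EndOp T →+ EndOp T :=
  AddMonoidHom.mk' (fun x => toEndOp (homComponent g (toEndOp_surjective hT x).choose))
    fun x y => by
      rw [← toEndOp_add, ← homComponent_add]
      refine toEndOp_eq_of_quotient_map_eq (quotient_map_homComponent_eq g
        (quotient_map_eq_of_toEndOp_eq hT ?_))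
      rw [toEndOp_add, (toEndOp_surjective hT _).choose_spec,
        (toEndOp_surjective hT _).choose_spec, (toEndOp_surjective hT _).choose_spec]

theorem endOpProj_toEndOp (hT : IsPerfect (forgetComplex T)) (g : G)
    (φ : forgetComplex T ⟶ forgetComplex T) :
    endOpProj hT g (toEndOp φ) = toEndOp (homComponent g φ) :=
  toEndOp_eq_of_quotient_map_eq (quotient_map_homComponent_eq g
    (quotient_map_eq_of_toEndOp_eq hT (toEndOp_surjective hT _).choose_spec))

/-- Homogeneous elements of `S` that are inverse to each other give an isomorphism between `T(g)`
and `T` in the homotopy category of graded modules. -/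
theorem nonempty_iso_of_toEndOp_mul_eq_one (hT : IsPerfect (forgetComplex T)) {g : G}
    {φ ψ : forgetComplex T ⟶ forgetComplex T} (hφ : IsHomogeneousHom g φ)
    (hψ : IsHomogeneousHom (-g) ψ) (h : toEndOp φ * toEndOp ψ = 1)
    (h' : toEndOp ψ * toEndOp φ = 1) :
    Nonempty ((HomotopyCategory.quotient _ _).obj (suspensionComplex g T) ≅
      (HomotopyCategory.quotient (GrMod 𝓡) (ComplexShape.up ℤ)).obj T) := by
  rw [← toEndOp_comp, ← toEndOp_id] at h h'
  replace h := quotient_map_eq_of_toEndOp_eq hT h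
  replace h' := quotient_map_eq_of_toEndOp_eq hT h'
  obtain ⟨b, rfl⟩ := hφ.exists_ofHomToSuspension_eq
  obtain ⟨a, rfl⟩ := hψ.exists_ofHomFromSuspension_eq
  refine ⟨⟨(HomotopyCategory.quotient _ _).map a, (HomotopyCategory.quotient _ _).map b, ?_, ?_⟩⟩
  · rw [← Functor.map_comp, ← CategoryTheory.Functor.map_id]
    apply quotient_map_eq_of_forget
    -- conjugate `h'` by the isomorphism between the underlying complexes of `T(g)` and `T`
    have h2 := congrArg (fun q =>
      (HomotopyCategory.quotient _ (ComplexShape.up ℤ)).map (forgetSuspensionIso g T).hom ≫ q ≫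
      (HomotopyCategory.quotient _ (ComplexShape.up ℤ)).map (forgetSuspensionIso g T).inv) h'
    simp only [← Functor.map_comp] at h2
    simpa [ofHomToSuspension, ofHomFromSuspension] using h2
  · rw [← Functor.map_comp, ← CategoryTheory.Functor.map_id]
    apply quotient_map_eq_of_forget
    simpa [ofHomToSuspension, ofHomFromSuspension] using h

end

variable [HasDerivedCategory.{w₁} (GrMod 𝓡)]

theorem gradedHomToEndOp_Q_map {g : G} (b : T ⟶ suspensionComplex g T) :
    gradedHomToEndOp T g (DerivedCategory.Q.map b) = toEndOp (ofHomToSuspension b) := by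
  refine congrArg MulOpposite.op ?_
  rw [Functor.mapDerivedCategoryFactors_hom_naturality_assoc, ofHomToSuspension, Functor.map_comp]
  simp

theorem IsHomogeneousHom.toEndOp_mem {g : G} {φ : forgetComplex T ⟶ forgetComplex T}
    (hφ : IsHomogeneousHom g φ) : toEndOp φ ∈ endOpComponent T g := by
  obtain ⟨b, rfl⟩ := hφ.exists_ofHomToSuspension_eq
  exact ⟨DerivedCategory.Q.map b, gradedHomToEndOp_Q_map b⟩

/-- If `T` is weakly invariant, then `1` is a sum of products of elements of degrees `-g` and `g`,
because the identity of `T(g)` is a sum of maps that factor through `T`. -/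
theorem IsWeaklyGInvariant.one_mem_closure (hw : IsWeaklyGInvariant T) (g : G) :
    (1 : EndOp T) ∈ AddSubgroup.closure
      {z | ∃ x ∈ endOpComponent T (-g), ∃ y ∈ endOpComponent T g, x * y = z} := by
  obtain ⟨n, α, β, hαβ⟩ := exists_sum_comp_eq_id (hw g)
  choose a ha using fun i =>
    (HomotopyCategory.quotient (GrMod 𝓡) (ComplexShape.up ℤ)).map_surjective (α i)
  choose b hb using fun i =>
    (HomotopyCategory.quotient (GrMod 𝓡) (ComplexShape.up ℤ)).map_surjective (β i)
  rw [← sum_toEndOp_mul_toEndOp_eq_one Finset.univ a b]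
  · exact sum_mem fun i _ => AddSubgroup.subset_closure
      ⟨_, (isHomogeneousHom_ofHomFromSuspension (a i)).toEndOp_mem,
        _, (isHomogeneousHom_ofHomToSuspension (b i)).toEndOp_mem, rfl⟩
  · rw [Functor.map_sum, CategoryTheory.Functor.map_id, ← hαβ]
    simp only [Functor.map_comp, ha, hb]

variable [GradedRing 𝓡]

/-- The elements of `S_g` are given by maps of complexes of degree `g`, because a bounded complex
of projective graded modules is K-projective. -/
theorem mem_endOpComponent_iff (hb : IsBoundedComplex T) (hT : IsPerfect (forgetComplex T))
    (g : G) (x : EndOp T) :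
    x ∈ endOpComponent T g ↔
      ∃ φ : forgetComplex T ⟶ forgetComplex T, IsHomogeneousHom g φ ∧ toEndOp φ = x := by
  constructor
  · rintro ⟨q, rfl⟩
    have := isKProjective_of_isPerfect hb hT
    obtain ⟨f, rfl⟩ := CochainComplex.IsKProjective.Q_map_surjective q
    exact ⟨_, isHomogeneousHom_ofHomToSuspension f, (gradedHomToEndOp_Q_map f).symm⟩
  · rintro ⟨φ, hφ, rfl⟩
    exact hφ.toEndOp_mem

theorem isInternal_endOpComponent (hb : IsBoundedComplex T) (hT : IsPerfect (forgetComplex T)) :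
    DirectSum.IsInternal (endOpComponent T) := by
  refine isInternal_of_proj _ (endOpProj hT) ?_ ?_ ?_ ?_
  · intro g x
    obtain ⟨φ, rfl⟩ := toEndOp_surjective hT x
    rw [endOpProj_toEndOp]
    exact (isHomogeneousHom_homComponent g φ).toEndOp_mem
  · intro g x hx
    obtain ⟨φ, hφ, rfl⟩ := (mem_endOpComponent_iff hb hT g x).1 hx
    rw [endOpProj_toEndOp, hφ.homComponent_same]
  · intro g h hne x hx
    obtain ⟨φ, hφ, rfl⟩ := (mem_endOpComponent_iff hb hT h x).1 hx
    rw [endOpProj_toEndOp, hφ.homComponent_ne hne, toEndOp_zero]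
  · intro x
    obtain ⟨φ, rfl⟩ := toEndOp_surjective hT x
    obtain ⟨s, hs⟩ := exists_sum_homComponent hT φ
    refine ⟨s, ?_⟩
    simp only [endOpProj_toEndOp]
    rw [← toEndOp_sum, ← hs]

/-- The components `S_g` make `S = End_{D(R)}(T)ᵒᵖ` a graded ring. -/
theorem nonempty_gradedRing_endOpComponent (hb : IsBoundedComplex T)
    (hT : IsPerfect (forgetComplex T)) : Nonempty (GradedRing (endOpComponent T)) := by
  refine ⟨{ (isInternal_endOpComponent hb hT).chooseDecomposition with
    one_mem := ?_
    mul_mem := ?_ }⟩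
  · rw [← toEndOp_id]
    refine IsHomogeneousHom.toEndOp_mem fun i k m hm => ?_
    rw [add_zero]
    exact hm
  · intro g h x y hx hy
    obtain ⟨φ, hφ, rfl⟩ := (mem_endOpComponent_iff hb hT g x).1 hx
    obtain ⟨ψ, hψ, rfl⟩ := (mem_endOpComponent_iff hb hT h y).1 hy
    rw [← toEndOp_comp]
    exact (hφ.comp hψ).toEndOp_mem

theorem IsWeaklyGInvariant.isStronglyGraded_endOpComponent (hw : IsWeaklyGInvariant T)
    (hb : IsBoundedComplex T) (hT : IsPerfect (forgetComplex T)) :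
    IsStronglyGraded (endOpComponent T) :=
  IsStronglyGraded.of_one_mem (nonempty_gradedRing_endOpComponent hb hT).some hw.one_mem_closure

/-- `S` is a crossed product if and only if `T` is invariant: units in `S_g` correspond to
isomorphisms `T ≅ T(g)` in the homotopy category. -/
theorem isCrossedProduct_endOpComponent_iff (hb : IsBoundedComplex T)
    (hT : IsPerfect (forgetComplex T)) :
    IsCrossedProduct (endOpComponent T) ↔ IsGInvariant T := by
  constructor
  · intro h g
    have := h.graded.some
    obtain ⟨_, hx, ⟨⟨x, y, hxy, hyx⟩, rfl⟩⟩ := h.exists_isUnit g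
    have hy := mem_neg_of_mul_eq_one (endOpComponent T) hx hxy hyx
    obtain ⟨φ, hφ, rfl⟩ := (mem_endOpComponent_iff hb hT g x).1 hx
    obtain ⟨ψ, hψ, rfl⟩ := (mem_endOpComponent_iff hb hT (-g) y).1 hy
    exact nonempty_iso_of_toEndOp_mul_eq_one hT hφ hψ hxy hyx
  · intro h
    refine ⟨nonempty_gradedRing_endOpComponent hb hT, fun g => ?_⟩
    obtain ⟨e⟩ := h g
    obtain ⟨a, ha⟩ := (HomotopyCategory.quotient _ _).map_surjective e.hom
    obtain ⟨b, hb'⟩ := (HomotopyCategory.quotient _ _).map_surjective e.inv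
    have h1 : toEndOp (ofHomFromSuspension a) * toEndOp (ofHomToSuspension b) = 1 := by
      have := sum_toEndOp_mul_toEndOp_eq_one {()} (fun _ => a) (fun _ => b) (by
        rw [Finset.sum_singleton, Functor.map_comp, ha, hb', e.hom_inv_id,
          CategoryTheory.Functor.map_id])
      rwa [Finset.sum_singleton] at this
    have h2 : toEndOp (ofHomToSuspension b) * toEndOp (ofHomFromSuspension a) = 1 := by
      rw [← toEndOp_comp, ← toEndOp_id]
      apply toEndOp_eq_of_quotient_map_eq
      have := quotient_map_forget_eq (f := b ≫ a) (f' := 𝟙 T) (by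
        rw [Functor.map_comp, ha, hb', e.inv_hom_id, CategoryTheory.Functor.map_id])
      simpa [ofHomToSuspension, ofHomFromSuspension] using this
    exact ⟨_, (isHomogeneousHom_ofHomToSuspension b).toEndOp_mem, ⟨⟨_, _, h2, h1⟩, rfl⟩⟩

end EndOp

theorem mainTheorem4 {G : Type v} [AddGroup G] [DecidableEq G] {R : Type u} [Ring R]
    (𝓡 : G → AddSubgroup R) [GradedRing 𝓡] (hR : IsStronglyGraded 𝓡)
    [HasDerivedCategory.{w₁} (GrMod 𝓡)] [HasDerivedCategory.{w₂} (ModuleCat.{u} R)]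
    [HasDerivedCategory.{w₃} (ModuleCat.{u} (𝓡 0))]
    (T : CochainComplex (GrMod 𝓡) ℤ) (hb : IsBoundedComplex T) (hT : IsWeaklyGInvariant T) :
    (IsTiltingComplex (identityComponentComplex T) ↔ IsGradedTiltingComplex T) ∧
    (IsGradedTiltingComplex T →
      IsStronglyGraded (endOpComponent T) ∧
      (IsCrossedProduct (endOpComponent T) ↔ IsGInvariant T)) :=
  ⟨hT.isTiltingComplex_iff hR, fun h =>
    ⟨hT.isStronglyGraded_endOpComponent hb h.perfect,
      isCrossedProduct_endOpComponent_iff hb h.perfect⟩⟩
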